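/- Let $n,d\ge 1$ be integers, $T\in(0,\infty)$, $x_0\in\mathbb R^n$, $A^\star\in\mathbb R^{n\times n}$, $B^\star\in\mathbb R^{n\times d}$, and let $Q\in\mathbb R^{n\times n}$ and $R\in\mathbb R^{d\times d}$ be symmetric positive definite. Let $W$ be an $n$-dimensional standard Brownian motion on a complete probability space, with $(\mathcal F_t)$ its filtration augmented by the null sets. For $\theta=(A,B)^\top\in\mathbb R^{(n+d)\times n}$ let $P^\theta$ be the solution of the Riccati equation $$\tfrac{\mathrm d}{\mathrm dt}P_t+A^\top P_t+P_tA-P_t(BR^{-1}B^\top)P_t+Q=0,\quad t\in[0,T];\qquad P_T=0,$$ put $K^\theta_t=-R^{-1}B^\top P^\theta_t$ and $\psi^\theta(t,x)=K^\theta_tx$, let $X^{\psi^\theta}$ be the continuous $(\mathcal F_t)$-adapted solution of $$\mathrm dX_t=\big(A^\star X_t+B^\star\psi^\theta(t,X_t)\big)\,\mathrm dt+\mathrm dW_t,\quad t\in[0,T];\qquad X_0=x_0,$$ and set $$Z^{\psi^\theta}_t=\begin{pmatrix}X^{\psi^\theta}_t\\ \psi^\theta(t,X^{\psi^\theta}_t)\end{pmatrix},\qquad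 V^{\psi^\theta}=\int_0^TZ^{\psi^\theta}_t(Z^{\psi^\theta}_t)^\top\,\mathrm dt .$$ These objects are well defined for every $\theta$: $P^\theta$ exists and is unique on $[0,T]$, $X^{\psi^\theta}$ exists and is unique up to indistinguishability on $[0,T]$, and the entries of $V^{\psi^\theta}$ are integrable. Moreover, for every $B\in\mathbb R^{n\times d}$ the following statements are equivalent: 1. $B$ has full column rank, i.e. $\operatorname{rank}B=d$; 2. for all $A\in\mathbb R^{n\times n}$, the matrix $\mathbb E[V^{\psi^\theta}]$ with $\theta=(A,B)^\top$ is symmetric positive definite; 3. for all $A\in\mathbb R^{n\times n}$ there exist $\lambda_0,\varepsilon>0$ such that $\lambda_{\min}(\mathbb E[V^{\psi^{\theta'}}])\ge\lambda_0$ for all $\theta'\in\mathbb R^{(n+d)\times n}$ with $|\theta'-\theta|\le\varepsilon$, where $\theta=(A,B)^\top$, $|\cdot|$ is the Euclidean norm on $\mathbb R^{(n+d)\times n}$, and $\lambda_{\min}$ is the minimum eigenvalue. -/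

import Mathlib

open MeasureTheory ProbabilityTheory
open scoped NNReal Matrix

noncomputable section

namespace LQRL

variable {n d : ℕ} {Ω : Type*}

/-- The parameter `θ = (A, B)ᵀ ∈ ℝ^{(n+d)×n}`. -/
def param (A : Matrix (Fin n) (Fin n) ℝ) (B : Matrix (Fin n) (Fin d) ℝ) :
    Matrix (Fin n ⊕ Fin d) (Fin n) ℝ :=
  Matrix.fromRows Aᵀ Bᵀ

/-- The block `A` of `θ = (A, B)ᵀ`. -/
def paramA (θ : Matrix (Fin n ⊕ Fin d) (Fin n) ℝ) : Matrix (Fin n) (Fin n) ℝ :=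
  θ.toRows₁ᵀ

/-- The block `B` of `θ = (A, B)ᵀ`. -/
def paramB (θ : Matrix (Fin n ⊕ Fin d) (Fin n) ℝ) : Matrix (Fin n) (Fin d) ℝ :=
  θ.toRows₂ᵀ

/-- The Euclidean norm `|M|` of a matrix, regarded as an element of a Euclidean space. -/
def euclNorm {ι κ : Type*} [Fintype ι] [Fintype κ] (M : Matrix ι κ ℝ) : ℝ :=
  √(∑ i, ∑ j, M i j ^ 2)

/-- The smallest eigenvalue of a symmetric matrix of positive size. -/
def minEigenvalue {ι : Type*} [Fintype ι] [DecidableEq ι] (M : Matrix ι ι ℝ) : ℝ :=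
  sInf {r : ℝ | Module.End.HasEigenvalue (Matrix.toLin' M) r}

/-- `P` solves the Riccati equation
`P' + Aᵀ P + P A - P (B R⁻¹ Bᵀ) P + Q = 0` on `[0, T]`, with `P_T = 0`
(one-sided derivatives at the end points). -/
structure IsRiccatiSolution (T : ℝ) (Q : Matrix (Fin n) (Fin n) ℝ) (R : Matrix (Fin d) (Fin d) ℝ)
    (A : Matrix (Fin n) (Fin n) ℝ) (B : Matrix (Fin n) (Fin d) ℝ)
    (P : ℝ → Matrix (Fin n) (Fin n) ℝ) : Prop where
  deriv_eq : ∀ t ∈ Set.Icc 0 T, ∀ i j, HasDerivWithinAt (fun s ↦ P s i j)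
    ((-(Aᵀ * P t + P t * A - P t * (B * R⁻¹ * Bᵀ) * P t + Q)) i j) (Set.Icc 0 T) t
  terminal : P T = 0

open Classical in
/-- The solution `P^θ` of the Riccati equation with parameter `θ = (A, B)ᵀ`. -/
def riccati (T : ℝ) (Q : Matrix (Fin n) (Fin n) ℝ) (R : Matrix (Fin d) (Fin d) ℝ)
    (θ : Matrix (Fin n ⊕ Fin d) (Fin n) ℝ) : ℝ → Matrix (Fin n) (Fin n) ℝ :=
  if h : ∃ P, IsRiccatiSolution T Q R (paramA θ) (paramB θ) P then h.choose else 0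

/-- The feedback matrix `K^θ_t = -R⁻¹ Bᵀ P^θ_t`. -/
def gain (T : ℝ) (Q : Matrix (Fin n) (Fin n) ℝ) (R : Matrix (Fin d) (Fin d) ℝ)
    (θ : Matrix (Fin n ⊕ Fin d) (Fin n) ℝ) (t : ℝ) : Matrix (Fin d) (Fin n) ℝ :=
  -(R⁻¹ * (paramB θ)ᵀ * riccati T Q R θ t)

/-- The feedback control `ψ^θ(t, x) = K^θ_t x`. -/
def policy (T : ℝ) (Q : Matrix (Fin n) (Fin n) ℝ) (R : Matrix (Fin d) (Fin d) ℝ)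
    (θ : Matrix (Fin n ⊕ Fin d) (Fin n) ℝ) (t : ℝ) (x : Fin n → ℝ) : Fin d → ℝ :=
  gain T Q R θ t *ᵥ x

/-- `W` is an `n`-dimensional standard Brownian motion: its coordinates are independent real
Brownian motions (started at `0`, almost surely continuous). -/
structure IsStandardBrownian {mΩ : MeasurableSpace Ω} (W : ℝ≥0 → Ω → Fin n → ℝ) (μ : Measure Ω) :
    Prop where
  coord : ∀ i, IsBrownianReal (fun t ω ↦ W t ω i) μ
  indep : iIndepFun (fun (i : Fin n) (ω : Ω) (t : ℝ≥0) ↦ W t ω i) μ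

/-- The σ-algebra `ℱ_t` generated by `W_s`, `s ≤ t`, and the null sets. -/
abbrev brownianSigma {mΩ : MeasurableSpace Ω} (W : ℝ≥0 → Ω → Fin n → ℝ) (μ : Measure Ω) (t : ℝ≥0) :
    MeasurableSpace Ω :=
  (⨆ s : Set.Iic t, MeasurableSpace.comap (W s) inferInstance) ⊔
    MeasurableSpace.generateFrom {N : Set Ω | μ N = 0}

/-- `X` is a strong solution on `[0, T]` of
`dX_t = (A⋆ X_t + B⋆ ψ(t, X_t)) dt + dW_t`, `X_0 = x₀`:
a continuous process, adapted to the augmented filtration of `W`, which almost surely satisfies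
the integral equation at all times. Values at times outside `[0, T]` are irrelevant. -/
structure IsStateProcess {mΩ : MeasurableSpace Ω} (T : ℝ) (x₀ : Fin n → ℝ)
    (Astar : Matrix (Fin n) (Fin n) ℝ) (Bstar : Matrix (Fin n) (Fin d) ℝ)
    (W : ℝ≥0 → Ω → Fin n → ℝ) (μ : Measure Ω) (ψ : ℝ → (Fin n → ℝ) → (Fin d → ℝ))
    (X : ℝ → Ω → Fin n → ℝ) : Prop where
  adapted : ∀ t ∈ Set.Icc 0 T, Measurable[brownianSigma W μ t.toNNReal] (X t)
  continuous : ∀ ω, ContinuousOn (fun t ↦ X t ω) (Set.Icc 0 T)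
  integral_eq : ∀ᵐ ω ∂μ, ∀ t ∈ Set.Icc 0 T,
    X t ω = x₀ + (∫ s in (0 : ℝ)..t, (Astar *ᵥ X s ω + Bstar *ᵥ ψ s (X s ω)))
      + W t.toNNReal ω

open Classical in
/-- The state process `X^ψ` controlled by the policy `ψ`. -/
def state {mΩ : MeasurableSpace Ω} (T : ℝ) (x₀ : Fin n → ℝ)
    (Astar : Matrix (Fin n) (Fin n) ℝ) (Bstar : Matrix (Fin n) (Fin d) ℝ)
    (W : ℝ≥0 → Ω → Fin n → ℝ) (μ : Measure Ω) (ψ : ℝ → (Fin n → ℝ) → (Fin d → ℝ)) :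
    ℝ → Ω → Fin n → ℝ :=
  if h : ∃ X, IsStateProcess T x₀ Astar Bstar W μ ψ X then h.choose else 0

/-- The joint state and control process `Z^ψ_t = (X^ψ_t, ψ(t, X^ψ_t))`. -/
def stateControl {mΩ : MeasurableSpace Ω} (T : ℝ) (x₀ : Fin n → ℝ)
    (Astar : Matrix (Fin n) (Fin n) ℝ) (Bstar : Matrix (Fin n) (Fin d) ℝ)
    (W : ℝ≥0 → Ω → Fin n → ℝ) (μ : Measure Ω) (ψ : ℝ → (Fin n → ℝ) → (Fin d → ℝ))
    (t : ℝ) (ω : Ω) : Fin n ⊕ Fin d → ℝ :=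
  Sum.elim (state T x₀ Astar Bstar W μ ψ t ω) (ψ t (state T x₀ Astar Bstar W μ ψ t ω))

/-- The random Gram matrix `V^ψ = ∫_0^T Z^ψ_t (Z^ψ_t)ᵀ dt`. -/
def gram {mΩ : MeasurableSpace Ω} (T : ℝ) (x₀ : Fin n → ℝ)
    (Astar : Matrix (Fin n) (Fin n) ℝ) (Bstar : Matrix (Fin n) (Fin d) ℝ)
    (W : ℝ≥0 → Ω → Fin n → ℝ) (μ : Measure Ω) (ψ : ℝ → (Fin n → ℝ) → (Fin d → ℝ))
    (ω : Ω) : Matrix (Fin n ⊕ Fin d) (Fin n ⊕ Fin d) ℝ :=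
  Matrix.of fun i j ↦ ∫ t in (0 : ℝ)..T,
    stateControl T x₀ Astar Bstar W μ ψ t ω i * stateControl T x₀ Astar Bstar W μ ψ t ω j

/-- The expected Gram matrix `𝔼[V^ψ]`. -/
def expectedGram {mΩ : MeasurableSpace Ω} (T : ℝ) (x₀ : Fin n → ℝ)
    (Astar : Matrix (Fin n) (Fin n) ℝ) (Bstar : Matrix (Fin n) (Fin d) ℝ)
    (W : ℝ≥0 → Ω → Fin n → ℝ) (μ : Measure Ω) (ψ : ℝ → (Fin n → ℝ) → (Fin d → ℝ)) :
    Matrix (Fin n ⊕ Fin d) (Fin n ⊕ Fin d) ℝ :=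
  Matrix.of fun i j ↦ ∫ ω, gram T x₀ Astar Bstar W μ ψ ω i j ∂μ

end LQRL

end

/-! The noise is additive and the policy is linear in the state, so for a fixed Brownian path the
state solves a deterministic linear equation driven by that path; no stochastic integral is needed.

For `v = (a, b)` the form `v ⬝ᵥ 𝔼[V] v` equals `𝔼 ∫ (v ⬝ᵥ Z_t)² dt`, and `v ⬝ᵥ Z_t = c(t) ⬝ᵥ X_t`
with `c(t) = a + K_tᵀ b`. If the form vanishes, then almost surely `c(t) ⬝ᵥ X_t = 0` on `[0, T]`.
Nondegeneracy of the noise then forces `c = 0` on `(0, T]`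
(`IsLinearProcess.eq_zero_of_dotProduct_eq_zero`): the relation would give `c(t) ⬝ᵥ (W_t - W_s)` a
second moment `O((t - s)²)`, whereas it is `|c(t)|² (t - s)`. At the terminal time `P_T = 0`, so
`K_T = 0` and `a = 0`; moreover `P'_T = -Q`, so `0 = c'(T) = Q B R⁻¹ b`, and full column rank of `B`
gives `b = 0`. Conversely, if `B x = 0` with `x ≠ 0`, then `b = R x` satisfies `K_tᵀ b = -P_tᵀ B x =
0` for all `t`, and `𝔼[V]` is singular for every `A`.

Statement 3 follows from 2 by continuity of `θ ↦ 𝔼[V]` (`continuousAt_expectedGram`). Pathwise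
Grönwall estimates give continuity of the state in `θ` and a dominating function that depends only
on the Brownian path. Taking `θ' = θ` in statement 3 excludes a singular `𝔼[V]`.

The Riccati solution is `L Y⁻¹`, where `(Y, L)` is a block column of the exponential of the
Hamiltonian matrix. Invertibility of `Y` (`isUnit_hamState`) yields global existence, uniqueness,
and joint continuity in `θ` and `t`. -/

noncomputable section

namespace LQRL

open Set Filter Topology

/-! ### Grönwall bounds and linear differential equations -/

section

variable {n d : ℕ}

/-- The sum of the absolute values of the entries of a matrix. -/
def absSum {ι κ : Type*} [Fintype ι] [Fintype κ] (M : Matrix ι κ ℝ) : ℝ :=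
  ∑ i, ∑ j, |M i j|

section absSum

variable {ι κ : Type*} [Fintype ι] [Fintype κ]

lemma absSum_nonneg (M : Matrix ι κ ℝ) : 0 ≤ absSum M := by
  unfold absSum; positivity

lemma norm_mulVec_le (M : Matrix ι κ ℝ) (x : κ → ℝ) : ‖M *ᵥ x‖ ≤ absSum M * ‖x‖ := by
  refine (pi_norm_le_iff_of_nonneg (mul_nonneg (absSum_nonneg M) (norm_nonneg x))).2 fun i ↦ ?_
  calc ‖(M *ᵥ x) i‖ = |∑ j, M i j * x j| := rfl
    _ ≤ ∑ j, |M i j * x j| := Finset.abs_sum_le_sum_abs _ _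
    _ ≤ ∑ j, |M i j| * ‖x‖ := by
        gcongr with j
        rw [abs_mul]
        gcongr
        exact norm_le_pi_norm x j
    _ = (∑ j, |M i j|) * ‖x‖ := by rw [Finset.sum_mul]
    _ ≤ absSum M * ‖x‖ := by
        gcongr
        exact Finset.single_le_sum (f := fun i ↦ ∑ j, |M i j|) (fun i _ ↦ by positivity)
          (Finset.mem_univ i)

lemma continuous_absSum : Continuous (absSum : Matrix ι κ ℝ → ℝ) := by
  unfold absSum
  fun_prop

lemma exists_absSum_le {F : ℝ → Matrix ι κ ℝ} (hF : Continuous F) (T : ℝ) :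
    ∃ L, 0 ≤ L ∧ ∀ t ∈ Icc 0 T, absSum (F t) ≤ L := by
  obtain ⟨L, hL⟩ := (isCompact_Icc (a := (0 : ℝ)) (b := T)).bddAbove_image
    (continuous_absSum.comp hF).continuousOn
  exact ⟨max L 0, le_max_right _ _, fun t ht ↦ (hL ⟨t, ht, rfl⟩).trans (le_max_left _ _)⟩

end absSum

lemma hasDerivWithinAt_const_add_integral {E : Type*} [NormedAddCommGroup E] [NormedSpace ℝ E]
    [CompleteSpace E] {f : ℝ → E} {T : ℝ} (hf : ContinuousOn f (Icc 0 T)) (x₀ : E) {t : ℝ}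
    (ht : t ∈ Icc 0 T) :
    HasDerivWithinAt (fun t ↦ x₀ + ∫ s in (0 : ℝ)..t, f s) (f t) (Icc 0 T) t :=
  -- The Picard operator of a field independent of the state is exactly this integral; its
  -- derivative lemma includes the one-sided cases at the end points.
  ODE.hasDerivWithinAt_picard_Icc (f := fun s _ ↦ f s) (α := fun _ ↦ x₀)
    (u := univ) (t₀ := 0) (left_mem_Icc.2 (ht.1.trans ht.2))
    (hf.comp continuousOn_fst (fun _ hp ↦ hp.1)) continuousOn_const (fun _ _ ↦ mem_univ _) x₀ ht

/-- The integral form of Grönwall's inequality. -/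
lemma le_mul_exp_of_le_integral {T L G : ℝ} {φ : ℝ → ℝ} (hφ : ContinuousOn φ (Icc 0 T))
    (hφ0 : ∀ t ∈ Icc 0 T, 0 ≤ φ t) (hG : 0 ≤ G) (hL : 0 ≤ L)
    (h : ∀ t ∈ Icc 0 T, φ t ≤ G + ∫ s in (0 : ℝ)..t, L * φ s) :
    ∀ t ∈ Icc 0 T, φ t ≤ G * Real.exp (L * T) := by
  intro t ht
  have hT : 0 ≤ T := ht.1.trans ht.2
  set u : ℝ → ℝ := fun t ↦ G + ∫ s in (0 : ℝ)..t, L * φ s with hu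
  have hLφ : ContinuousOn (fun s ↦ L * φ s) (Icc 0 T) := continuousOn_const.mul hφ
  have hd : ∀ x ∈ Icc 0 T, HasDerivWithinAt u (L * φ x) (Icc 0 T) x := by
    intro x hx
    exact hasDerivWithinAt_const_add_integral hLφ G hx
  have hu0 : ∀ x ∈ Icc 0 T, 0 ≤ u x := fun x hx ↦ (hφ0 x hx).trans (h x hx)
  have := norm_le_gronwallBound_of_norm_deriv_right_le (f := u) (f' := fun x ↦ L * φ x)
    (δ := G) (K := L) (ε := 0) (a := 0) (b := T)
    (fun x hx ↦ (hd x hx).continuousWithinAt)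
    (fun x hx ↦ (hd x (Ico_subset_Icc_self hx)).mono_of_mem_nhdsWithin
      (Icc_mem_nhdsGE_of_mem hx))
    (by simp [hu, abs_of_nonneg hG]) ?_ t ht
  · rw [gronwallBound_ε0, sub_zero, Real.norm_of_nonneg (hu0 t ht)] at this
    refine (h t ht).trans (this.trans ?_)
    gcongr
    exact ht.2
  · intro x hx
    have hx' := Ico_subset_Icc_self hx
    rw [add_zero, Real.norm_of_nonneg (mul_nonneg hL (hφ0 x hx')),
      Real.norm_of_nonneg (hu0 x hx')]
    gcongr
    exact h x hx'

/-- The coordinatewise projection onto the cube `[-ρ, ρ]^ι`. -/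
def cubeProj {ι : Type*} (ρ : ℝ) (x : ι → ℝ) : ι → ℝ := fun i ↦ max (-ρ) (min ρ (x i))

section cubeProj

variable {ι : Type*} [Fintype ι] {ρ : ℝ}

lemma norm_cubeProj_sub_le (x y : ι → ℝ) : ‖cubeProj ρ x - cubeProj ρ y‖ ≤ ‖x - y‖ := by
  refine (pi_norm_le_iff_of_nonneg (norm_nonneg _)).2 fun i ↦ ?_
  refine le_trans ?_ (norm_le_pi_norm (x - y) i)
  simp only [cubeProj, Pi.sub_apply, Real.norm_eq_abs]
  refine (abs_max_sub_max_le_max _ _ _ _).trans (max_le (by simp) ?_)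
  exact (abs_min_sub_min_le_max _ _ _ _).trans (max_le (by simp) le_rfl)

lemma norm_cubeProj_le (hρ : 0 ≤ ρ) (x : ι → ℝ) : ‖cubeProj ρ x‖ ≤ ρ := by
  refine (pi_norm_le_iff_of_nonneg hρ).2 fun i ↦ abs_le.2 ⟨le_max_left _ _, ?_⟩
  exact max_le (by linarith) (min_le_left _ _)

lemma cubeProj_eq_self {x : ι → ℝ} (hx : ‖x‖ ≤ ρ) : cubeProj ρ x = x := by
  ext i
  have := abs_le.1 ((norm_le_pi_norm x i).trans hx)
  simp [cubeProj, this.1, this.2]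

lemma norm_cubeProj_le_norm (hρ : 0 ≤ ρ) (x : ι → ℝ) : ‖cubeProj ρ x‖ ≤ ‖x‖ := by
  have := norm_cubeProj_sub_le (ρ := ρ) x 0
  rwa [cubeProj_eq_self (x := (0 : ι → ℝ)) (by simpa using hρ), sub_zero, sub_zero] at this

end cubeProj

section linearODE

variable {ι : Type*} [Fintype ι]

/-- Linear differential equations with continuous coefficients have global solutions. -/
lemma exists_linearODE_solution {F : ℝ → Matrix ι ι ℝ} (hF : Continuous F) {T : ℝ} (hT : 0 ≤ T)
    (x₀ : ι → ℝ) :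
    ∃ α : ℝ → ι → ℝ, α 0 = x₀ ∧
      ∀ t ∈ Icc 0 T, HasDerivWithinAt α (F t *ᵥ α t) (Icc 0 T) t := by
  obtain ⟨L, hL0, hL⟩ := exists_absSum_le hF T
  -- `ρ` is the a priori Grönwall bound for the solution. Truncating the state at `ρ` makes the
  -- field bounded by `L * ρ`, so Picard–Lindelöf applies on all of `[0, T]` at once.
  set ρ : ℝ := ‖x₀‖ * Real.exp (L * T) with hρ
  have hρ0 : 0 ≤ ρ := by positivity
  have hpl : IsPicardLindelof (fun t x ↦ F t *ᵥ cubeProj ρ x) (tmin := 0) (tmax := T)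
      ⟨0, left_mem_Icc.2 hT⟩ x₀ ⟨L * ρ * T, by positivity⟩ 0 ⟨L * ρ, by positivity⟩ ⟨L, hL0⟩ := by
    refine ⟨fun t ht ↦ ?_, fun x _ ↦ ?_, fun t ht x _ ↦ ?_, ?_⟩
    · refine LipschitzOnWith.of_dist_le_mul fun x _ y _ ↦ ?_
      rw [dist_eq_norm, dist_eq_norm, ← Matrix.mulVec_sub]
      refine (norm_mulVec_le _ _).trans ?_
      exact mul_le_mul (hL t ht) (norm_cubeProj_sub_le x y) (norm_nonneg _) hL0
    · exact (hF.matrix_mulVec continuous_const).continuousOn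
    · refine (norm_mulVec_le _ _).trans ?_
      exact mul_le_mul (hL t ht) (norm_cubeProj_le hρ0 x) (norm_nonneg _) hL0
    · simp only [sub_zero, sub_self, max_eq_left hT, NNReal.coe_zero]
      exact le_rfl
  obtain ⟨α, hα0, hα⟩ := hpl.exists_eq_forall_mem_Icc_hasDerivWithinAt₀
  simp only at hα0
  have hαc : ContinuousOn α (Icc 0 T) := fun t ht ↦ (hα t ht).continuousWithinAt
  -- Truncation does not increase the norm, so the truncated equation obeys the same Grönwall bound
  -- and the truncation is never active.
  have hbound : ∀ t ∈ Icc 0 T, ‖α t‖ ≤ ρ := by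
    intro t ht
    have := norm_le_gronwallBound_of_norm_deriv_right_le (f := α) (δ := ‖x₀‖) (K := L) (ε := 0)
      hαc (fun x hx ↦ (hα x (Ico_subset_Icc_self hx)).mono_of_mem_nhdsWithin
        (Icc_mem_nhdsGE_of_mem hx)) (by rw [hα0]) ?_ t ht
    · rw [gronwallBound_ε0, sub_zero] at this
      refine this.trans ?_
      rw [hρ]
      gcongr
      exact ht.2
    · intro x hx
      rw [add_zero]
      exact (norm_mulVec_le _ _).trans (mul_le_mul (hL x (Ico_subset_Icc_self hx))
        (norm_cubeProj_le_norm hρ0 _) (norm_nonneg _) hL0)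
  refine ⟨α, hα0, fun t ht ↦ ?_⟩
  have := hα t ht
  rwa [cubeProj_eq_self (hbound t ht)] at this

omit [Fintype ι] in
lemma hasDerivWithinAt_mulVec {κ : Type*} [Fintype κ] {M M' : ℝ → Matrix ι κ ℝ}
    {v v' : ℝ → κ → ℝ} {s : Set ℝ}
    {t : ℝ} (hM : ∀ i j, HasDerivWithinAt (fun s ↦ M s i j) (M' t i j) s t)
    (hv : HasDerivWithinAt v (v' t) s t) :
    HasDerivWithinAt (fun s ↦ M s *ᵥ v s) (M' t *ᵥ v t + M t *ᵥ v' t) s t := by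
  rw [hasDerivWithinAt_pi] at hv ⊢
  intro i
  have := HasDerivWithinAt.fun_sum (u := Finset.univ) (fun j _ ↦ (hM i j).mul (hv j))
  simpa [Matrix.mulVec, dotProduct, Finset.sum_add_distrib] using! this

omit [Fintype ι] in
lemma hasDerivWithinAt_matrix_mul {κ τ : Type*} [Fintype κ] {M M' : ℝ → Matrix ι κ ℝ}
    {N N' : ℝ → Matrix κ τ ℝ} {s : Set ℝ} {t : ℝ}
    (hM : ∀ i j, HasDerivWithinAt (fun s ↦ M s i j) (M' t i j) s t)
    (hN : ∀ i j, HasDerivWithinAt (fun s ↦ N s i j) (N' t i j) s t) (i : ι) (j : τ) :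
    HasDerivWithinAt (fun s ↦ (M s * N s) i j) ((M' t * N t + M t * N' t) i j) s t := by
  have := HasDerivWithinAt.fun_sum (u := Finset.univ) (fun k _ ↦ (hM i k).mul (hN k j))
  simpa [Matrix.mul_apply, Finset.sum_add_distrib] using! this

/-- A linear differential equation has a fundamental matrix, together with its inverse. -/
lemma exists_fundamentalMatrix [DecidableEq ι] {F : ℝ → Matrix ι ι ℝ} (hF : Continuous F) {T : ℝ}
    (hT : 0 ≤ T) :
    ∃ Φ Ψ : ℝ → Matrix ι ι ℝ, Φ 0 = 1 ∧ ContinuousOn Φ (Icc 0 T) ∧ ContinuousOn Ψ (Icc 0 T) ∧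
      (∀ t ∈ Icc 0 T, Φ t * Ψ t = 1) ∧
      ∀ t ∈ Icc 0 T, ∀ i j, HasDerivWithinAt (fun s ↦ Φ s i j) ((F t * Φ t) i j) (Icc 0 T) t := by
  choose α hα0 hα using fun j ↦ exists_linearODE_solution hF hT (Pi.single j 1)
  -- Solutions of the adjoint equation are the rows of `Ψ`. Hence `Ψ' = -ΨF`, the product `Ψ Φ` has
  -- zero derivative, and no invertibility argument is needed.
  choose β hβ0 hβ using fun j ↦ exists_linearODE_solution (F := fun t ↦ -(F t)ᵀ)
    (hF.matrix_transpose.neg) hT (Pi.single j 1)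
  set Φ : ℝ → Matrix ι ι ℝ := fun t ↦ Matrix.of fun i j ↦ α j t i with hΦ
  set Ψ : ℝ → Matrix ι ι ℝ := fun t ↦ Matrix.of fun i j ↦ β i t j with hΨ
  have dΦ : ∀ t ∈ Icc 0 T, ∀ i j,
      HasDerivWithinAt (fun s ↦ Φ s i j) ((F t * Φ t) i j) (Icc 0 T) t := fun t ht i j ↦
    hasDerivWithinAt_pi.1 (hα j t ht) i
  have dΨ : ∀ t ∈ Icc 0 T, ∀ i j,
      HasDerivWithinAt (fun s ↦ Ψ s i j) ((-(Ψ t * F t)) i j) (Icc 0 T) t := fun t ht i j ↦ by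
    refine (hasDerivWithinAt_pi.1 (hβ i t ht) j).congr_deriv ?_
    simp [hΨ, Matrix.mul_apply, Matrix.mulVec, dotProduct, mul_comm]
  have hΦ0 : Φ 0 = 1 := by
    ext i j
    simp [hΦ, hα0, Matrix.one_apply, Pi.single_apply]
  have hΨ0 : Ψ 0 = 1 := by
    ext i j
    simp [hΨ, hβ0, Matrix.one_apply, Pi.single_apply, eq_comm]
  have hinv : ∀ t ∈ Icc 0 T, Ψ t * Φ t = 1 := by
    intro t ht
    ext i j
    have hd : ∀ t ∈ Icc 0 T, HasDerivWithinAt (fun s ↦ (Ψ s * Φ s) i j) 0 (Icc 0 T) t := by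
      intro t ht
      have := hasDerivWithinAt_matrix_mul (M' := fun t ↦ -(Ψ t * F t)) (N' := fun t ↦ F t * Φ t)
        (dΨ t ht) (dΦ t ht) i j
      simpa [Matrix.mul_assoc] using this
    have := constant_of_has_deriv_right_zero (fun t ht ↦ (hd t ht).continuousWithinAt)
      (fun x hx ↦ (hd x (Ico_subset_Icc_self hx)).mono_of_mem_nhdsWithin
        (Icc_mem_nhdsGE_of_mem hx)) t ht
    rw [this, hΦ0, hΨ0, mul_one]
  refine ⟨Φ, Ψ, hΦ0, ?_, ?_, fun t ht ↦ mul_eq_one_comm.1 (hinv t ht), dΦ⟩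
  · exact continuousOn_pi.2 fun i ↦ continuousOn_pi.2 fun j t ht ↦ (dΦ t ht i j).continuousWithinAt
  · exact continuousOn_pi.2 fun i ↦ continuousOn_pi.2 fun j t ht ↦ (dΨ t ht i j).continuousWithinAt

/-- The variation of constants formula. -/
lemma variation_of_constants [DecidableEq ι] {F Φ Ψ : ℝ → Matrix ι ι ℝ} (hF : Continuous F) {T : ℝ}
    (hΦ0 : Φ 0 = 1) (hΨ : ContinuousOn Ψ (Icc 0 T))
    (hinv : ∀ t ∈ Icc 0 T, Φ t * Ψ t = 1)
    (hd : ∀ t ∈ Icc 0 T, ∀ i j,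
      HasDerivWithinAt (fun s ↦ Φ s i j) ((F t * Φ t) i j) (Icc 0 T) t)
    (x₀ : ι → ℝ) {g : ℝ → ι → ℝ} (hg : Continuous g) {y : ℝ → ι → ℝ}
    (hy : ∀ t, y t = Φ t *ᵥ (x₀ + ∫ s in (0 : ℝ)..t, Ψ s *ᵥ (F s *ᵥ g s))) :
    ContinuousOn y (Icc 0 T) ∧
      ∀ t ∈ Icc 0 T, y t = x₀ + ∫ s in (0 : ℝ)..t, F s *ᵥ (y s + g s) := by
  -- With `g` a noise path, `y` is the state minus the noise. This difference is differentiable even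
  -- though `g` is merely continuous.
  have hdy : ∀ t ∈ Icc 0 T, HasDerivWithinAt y (F t *ᵥ (y t + g t)) (Icc 0 T) t := by
    intro t ht
    have hz := hasDerivWithinAt_const_add_integral (f := fun s ↦ Ψ s *ᵥ (F s *ᵥ g s)) (T := T)
      (by
        refine continuousOn_pi.2 fun i ↦ ?_
        simp only [Matrix.mulVec, dotProduct]
        have h1 := fun i j ↦ continuousOn_pi.1 (continuousOn_pi.1 hΨ i) j
        fun_prop) x₀ ht
    have := hasDerivWithinAt_mulVec (M' := fun t ↦ F t * Φ t)
      (v' := fun s ↦ Ψ s *ᵥ (F s *ᵥ g s)) (hd t ht) hz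
    rw [← funext hy] at this
    convert this using 1
    rw [← Matrix.mulVec_mulVec, ← hy t, Matrix.mulVec_mulVec, hinv t ht, Matrix.one_mulVec,
      Matrix.mulVec_add]
  have hyc : ContinuousOn y (Icc 0 T) := fun t ht ↦ (hdy t ht).continuousWithinAt
  refine ⟨hyc, fun t ht ↦ ?_⟩
  have hy0 : y 0 = x₀ := by simp [hy, hΦ0]
  have hsub : uIcc 0 t ⊆ Icc 0 T := by
    rw [uIcc_of_le ht.1]
    exact Icc_subset_Icc_right ht.2
  have := ODE.picard_eq_of_hasDerivAt (f := fun s x ↦ F s *ᵥ (x + g s)) (α := y) (u := univ)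
    (t₀ := 0) (t := t) (Continuous.continuousOn (by fun_prop))
    (fun s hs ↦ (hdy s (hsub hs)).mono hsub) (fun _ _ ↦ mem_univ _)
  rw [← this, ODE.picard_apply, hy0]

end linearODE

/-- The Cauchy-Schwarz inequality against a constant, for interval integrals. -/
lemma sq_intervalIntegral_le {a b : ℝ} (hab : a ≤ b) {f : ℝ → ℝ} (hf : ContinuousOn f (Icc a b)) :
    (∫ s in a..b, f s) ^ 2 ≤ (b - a) * ∫ s in a..b, f s ^ 2 := by
  rcases hab.eq_or_lt with rfl | hlt
  · simp
  set m := ∫ s in a..b, f s with hm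
  have hfi : IntervalIntegrable f volume a b := by
    apply ContinuousOn.intervalIntegrable; rwa [uIcc_of_le hab]
  have hf2 : IntervalIntegrable (fun s ↦ f s ^ 2) volume a b := by
    apply ContinuousOn.intervalIntegrable; rw [uIcc_of_le hab]; exact hf.pow 2
  -- `c` is the mean of `f`; the inequality is nonnegativity of the integral of `(f - c)²`.
  set c := m / (b - a) with hc
  have h0 : 0 ≤ ∫ s in a..b, (f s - c) ^ 2 :=
    intervalIntegral.integral_nonneg hab fun _ _ ↦ sq_nonneg _
  have h1 : ∫ s in a..b, (f s - c) ^ 2 =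
      (∫ s in a..b, f s ^ 2) - 2 * c * m + (b - a) * c ^ 2 := by
    have : (fun s ↦ (f s - c) ^ 2) = fun s ↦ (f s ^ 2 - 2 * c * f s) + c ^ 2 := by
      ext s; ring
    rw [this, intervalIntegral.integral_add (hf2.sub (hfi.const_mul _)) (by simp),
      intervalIntegral.integral_sub hf2 (hfi.const_mul _), intervalIntegral.integral_const_mul,
      intervalIntegral.integral_const, smul_eq_mul]
  have hba : 0 < b - a := sub_pos.2 hlt
  have hcm : m = c * (b - a) := by rw [hc]; field_simp
  rw [h1, hcm] at h0
  rw [hcm]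
  nlinarith

end

/-! ### The Riccati equation through the Hamiltonian flow -/

section

variable {n d : ℕ}

/-- The Hamiltonian matrix of a linear-quadratic control problem. -/
def hamiltonian (A S Q : Matrix (Fin n) (Fin n) ℝ) : Matrix (Fin n ⊕ Fin n) (Fin n ⊕ Fin n) ℝ :=
  Matrix.fromBlocks A (-S) (-Q) (-Aᵀ)

/-- The flow of the Hamiltonian system which is the identity at time `T`. -/
def hamFlow (T : ℝ) (A S Q : Matrix (Fin n) (Fin n) ℝ) (t : ℝ) :
    Matrix (Fin n ⊕ Fin n) (Fin n ⊕ Fin n) ℝ :=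
  NormedSpace.exp ((t - T) • hamiltonian A S Q)

/-- The state block of the Hamiltonian flow. -/
def hamState (T : ℝ) (A S Q : Matrix (Fin n) (Fin n) ℝ) (t : ℝ) : Matrix (Fin n) (Fin n) ℝ :=
  (hamFlow T A S Q t).toBlocks₁₁

/-- The costate block of the Hamiltonian flow. -/
def hamCostate (T : ℝ) (A S Q : Matrix (Fin n) (Fin n) ℝ) (t : ℝ) : Matrix (Fin n) (Fin n) ℝ :=
  (hamFlow T A S Q t).toBlocks₂₁

/-- The solution of the Riccati equation obtained from the Hamiltonian flow. -/
def hamRiccati (T : ℝ) (A S Q : Matrix (Fin n) (Fin n) ℝ) (t : ℝ) : Matrix (Fin n) (Fin n) ℝ :=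
  hamCostate T A S Q t * (hamState T A S Q t)⁻¹

section flow

open scoped Matrix.Norms.Operator

variable (T : ℝ) (A S Q : Matrix (Fin n) (Fin n) ℝ)

lemma hasDerivAt_hamFlow (t : ℝ) :
    HasDerivAt (hamFlow T A S Q) (hamiltonian A S Q * hamFlow T A S Q t) t := by
  have h := (hasDerivAt_exp_smul_const' (𝕂 := ℝ) (hamiltonian A S Q) (t - T)).scomp t
    ((hasDerivAt_id t).sub_const T)
  simpa [Function.comp_def] using! h

lemma hasDerivAt_apply_of_hasDerivAt {ι κ : Type*} [Fintype ι] [Fintype κ]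
    {M : ℝ → Matrix ι κ ℝ} {M' : Matrix ι κ ℝ} {t : ℝ} (h : HasDerivAt M M' t) (i : ι) (j : κ) :
    HasDerivAt (fun s ↦ M s i j) (M' i j) t :=
  (LinearMap.toContinuousLinearMap (Matrix.entryLinearMap ℝ ℝ i j)).hasFDerivAt.comp_hasDerivAt t h

lemma hasDerivAt_hamState_matrix (t : ℝ) : HasDerivAt (hamState T A S Q)
    (A * hamState T A S Q t - S * hamCostate T A S Q t) t := by
  let ℓ : Matrix (Fin n ⊕ Fin n) (Fin n ⊕ Fin n) ℝ →ₗ[ℝ] Matrix (Fin n) (Fin n) ℝ :=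
    { toFun := Matrix.toBlocks₁₁, map_add' := fun _ _ ↦ rfl, map_smul' := fun _ _ ↦ rfl }
  refine ((LinearMap.toContinuousLinearMap ℓ).hasFDerivAt.comp_hasDerivAt t
    (hasDerivAt_hamFlow T A S Q t)).congr_deriv ?_
  change (hamiltonian A S Q * hamFlow T A S Q t).toBlocks₁₁ = _
  rw [hamState, hamCostate, hamiltonian]
  conv_lhs => rw [← Matrix.fromBlocks_toBlocks (hamFlow T A S Q t), Matrix.fromBlocks_multiply]
  simp [sub_eq_add_neg]

lemma hasDerivAt_hamCostate_matrix (t : ℝ) : HasDerivAt (hamCostate T A S Q)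
    (-(Q * hamState T A S Q t) - Aᵀ * hamCostate T A S Q t) t := by
  let ℓ : Matrix (Fin n ⊕ Fin n) (Fin n ⊕ Fin n) ℝ →ₗ[ℝ] Matrix (Fin n) (Fin n) ℝ :=
    { toFun := Matrix.toBlocks₂₁, map_add' := fun _ _ ↦ rfl, map_smul' := fun _ _ ↦ rfl }
  refine ((LinearMap.toContinuousLinearMap ℓ).hasFDerivAt.comp_hasDerivAt t
    (hasDerivAt_hamFlow T A S Q t)).congr_deriv ?_
  change (hamiltonian A S Q * hamFlow T A S Q t).toBlocks₂₁ = _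
  rw [hamState, hamCostate, hamiltonian]
  conv_lhs => rw [← Matrix.fromBlocks_toBlocks (hamFlow T A S Q t), Matrix.fromBlocks_multiply]
  simp [sub_eq_add_neg]

lemma hamState_terminal : hamState T A S Q T = 1 := by
  simp [hamState, hamFlow, NormedSpace.exp_zero, ← Matrix.fromBlocks_one]

lemma hamCostate_terminal : hamCostate T A S Q T = 0 := by
  simp [hamCostate, hamFlow, NormedSpace.exp_zero, ← Matrix.fromBlocks_one]

/-- The explicit exponential makes continuity in the coefficients and time immediate. This is what
later gives continuity of the gain in `θ`. -/
lemma continuous_hamFlow :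
    Continuous fun p : (Matrix (Fin n) (Fin n) ℝ × Matrix (Fin n) (Fin n) ℝ) × ℝ ↦
      hamFlow T p.1.1 p.1.2 Q p.2 := by
  refine NormedSpace.exp_continuous.comp ?_
  unfold hamiltonian
  exact (continuous_snd.sub continuous_const).smul
    ((continuous_fst.comp continuous_fst).matrix_fromBlocks (continuous_snd.comp continuous_fst).neg
      continuous_const (continuous_fst.comp continuous_fst).matrix_transpose.neg)

lemma hasDerivAt_inv_matrix {M : ℝ → Matrix (Fin n) (Fin n) ℝ} {M' : Matrix (Fin n) (Fin n) ℝ}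
    {t : ℝ} (h : HasDerivAt M M' t) (hu : IsUnit (M t)) :
    HasDerivAt (fun s ↦ (M s)⁻¹) (-((M t)⁻¹ * M' * (M t)⁻¹)) t := by
  obtain ⟨u, hu⟩ := hu
  have h1 := hasFDerivAt_ringInverse (𝕜 := ℝ) u
  rw [hu] at h1
  have h2 := h1.comp_hasDerivAt t h
  simp only [Matrix.nonsing_inv_eq_ringInverse]
  refine h2.congr_deriv ?_
  rw [← hu, Ring.inverse_unit]
  simp [ContinuousLinearMap.mulLeftRight_apply]

end flow

section riccati

variable {T : ℝ} {A S Q : Matrix (Fin n) (Fin n) ℝ}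

open scoped Matrix.Norms.Operator in
lemma hasDerivAt_hamState (t : ℝ) (i j : Fin n) : HasDerivAt (fun s ↦ hamState T A S Q s i j)
    ((A * hamState T A S Q t - S * hamCostate T A S Q t) i j) t :=
  hasDerivAt_apply_of_hasDerivAt (hasDerivAt_hamState_matrix T A S Q t) i j

open scoped Matrix.Norms.Operator in
lemma hasDerivAt_hamCostate (t : ℝ) (i j : Fin n) : HasDerivAt (fun s ↦ hamCostate T A S Q s i j)
    ((-(Q * hamState T A S Q t) - Aᵀ * hamCostate T A S Q t) i j) t :=
  hasDerivAt_apply_of_hasDerivAt (hasDerivAt_hamCostate_matrix T A S Q t) i j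

lemma hasDerivAt_dotProduct {v v' w w' : ℝ → Fin n → ℝ} {t : ℝ} (hv : HasDerivAt v (v' t) t)
    (hw : HasDerivAt w (w' t) t) :
    HasDerivAt (fun s ↦ v s ⬝ᵥ w s) (v' t ⬝ᵥ w t + v t ⬝ᵥ w' t) t := by
  rw [hasDerivAt_pi] at hv hw
  have := HasDerivAt.fun_sum (u := Finset.univ) (fun j _ ↦ (hv j).mul (hw j))
  simpa [dotProduct, Finset.sum_add_distrib] using! this

/-- Suppose `Y(t) v = 0` and put `y = Y v`, `l = L v`. Then `(y ⬝ᵥ l)' = -l ⬝ᵥ S l - y ⬝ᵥ Q y ≤ 0`,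
and `y ⬝ᵥ l` vanishes at `t` and, since `L(T) = 0`, also at `T`. By monotonicity it vanishes in
between, so its derivative at `T`, which is `-v ⬝ᵥ Q v`, is zero; definiteness of `Q` gives `v = 0`.
-/
lemma isUnit_hamState (hS : S.PosSemidef) (hQ : Q.PosDef) (t : ℝ) :
    IsUnit (hamState T A S Q t) := by
  rw [Matrix.isUnit_iff_isUnit_det, isUnit_iff_ne_zero]
  intro hdet
  obtain ⟨v, hv0, hv⟩ := Matrix.exists_mulVec_eq_zero_iff.2 hdet
  set y : ℝ → Fin n → ℝ := fun s ↦ hamState T A S Q s *ᵥ v with hy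
  set l : ℝ → Fin n → ℝ := fun s ↦ hamCostate T A S Q s *ᵥ v with hl
  have dy : ∀ s, HasDerivAt y (A *ᵥ y s - S *ᵥ l s) s := by
    intro s
    have := hasDerivWithinAt_mulVec (M := hamState T A S Q) (s := univ) (v := fun _ ↦ v)
      (v' := fun _ ↦ 0) (M' := fun s ↦ A * hamState T A S Q s - S * hamCostate T A S Q s)
      (fun i j ↦ (hasDerivAt_hamState s i j).hasDerivWithinAt) (hasDerivWithinAt_const s univ v)
    simpa [hasDerivWithinAt_univ, Matrix.sub_mulVec, hy, hl, Matrix.mulVec_mulVec] using this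
  have dl : ∀ s, HasDerivAt l (-(Q *ᵥ y s) - Aᵀ *ᵥ l s) s := by
    intro s
    have := hasDerivWithinAt_mulVec (M := hamCostate T A S Q) (s := univ) (v := fun _ ↦ v)
      (v' := fun _ ↦ 0) (M' := fun s ↦ -(Q * hamState T A S Q s) - Aᵀ * hamCostate T A S Q s)
      (fun i j ↦ (hasDerivAt_hamCostate s i j).hasDerivWithinAt) (hasDerivWithinAt_const s univ v)
    simpa [hasDerivWithinAt_univ, Matrix.sub_mulVec, Matrix.neg_mulVec, hy, hl,
      Matrix.mulVec_mulVec] using this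
  have dφ : ∀ s, HasDerivAt (fun s ↦ y s ⬝ᵥ l s) (-(l s ⬝ᵥ (S *ᵥ l s)) - y s ⬝ᵥ (Q *ᵥ y s)) s := by
    intro s
    refine (hasDerivAt_dotProduct (v' := fun s ↦ A *ᵥ y s - S *ᵥ l s)
      (w' := fun s ↦ -(Q *ᵥ y s) - Aᵀ *ᵥ l s) (dy s) (dl s)).congr_deriv ?_
    have h1 : y s ⬝ᵥ (Aᵀ *ᵥ l s) = (A *ᵥ y s) ⬝ᵥ l s := by
      rw [Matrix.mulVec_transpose, dotProduct_comm, ← Matrix.dotProduct_mulVec, dotProduct_comm]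
    rw [sub_dotProduct, dotProduct_sub, dotProduct_neg, h1, dotProduct_comm (S *ᵥ l s)]
    ring
  have hanti : Antitone fun s ↦ y s ⬝ᵥ l s := by
    refine antitone_of_deriv_nonpos (fun s ↦ (dφ s).differentiableAt) fun s ↦ ?_
    rw [(dφ s).deriv]
    have h1 : 0 ≤ l s ⬝ᵥ (S *ᵥ l s) := by simpa using hS.dotProduct_mulVec_nonneg (l s)
    have h2 : 0 ≤ y s ⬝ᵥ (Q *ᵥ y s) := by
      simpa using hQ.posSemidef.dotProduct_mulVec_nonneg (y s)
    linarith
  have hyT : y T = v := by simp [hy, hamState_terminal]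
  have hlT : l T = 0 := by simp [hl, hamCostate_terminal]
  have hφT : y T ⬝ᵥ l T = 0 := by simp [hlT]
  have hyt : y t = 0 := hv
  have hφt : y t ⬝ᵥ l t = 0 := by simp [hyt]
  have htT : t ≠ T := by
    rintro rfl
    exact hv0 (hyT.symm.trans hyt)
  have hQv : v ⬝ᵥ (Q *ᵥ v) = 0 := by
    have hzero : ∀ s ∈ uIcc t T, y s ⬝ᵥ l s = 0 := by
      intro s hs
      rcases le_total t T with h | h
      · rw [uIcc_of_le h] at hs
        exact le_antisymm (hφt ▸ hanti hs.1) (hφT ▸ hanti hs.2)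
      · rw [uIcc_of_ge h] at hs
        exact le_antisymm (hφT ▸ hanti hs.1) (hφt ▸ hanti hs.2)
    -- The derivative at `T` is taken within the interval towards `t`, whichever side of `T` that
    -- is; it is unique because `t ≠ T`.
    have hd := (dφ T).hasDerivWithinAt (s := uIcc t T)
    have hd' : HasDerivWithinAt (fun s ↦ y s ⬝ᵥ l s) 0 (uIcc t T) T :=
      (hasDerivWithinAt_const T (uIcc t T) (0 : ℝ)).congr hzero hφT
    have huniq : UniqueDiffWithinAt ℝ (uIcc t T) T :=
      uniqueDiffOn_Icc (by simpa using htT.symm) _ right_mem_uIcc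
    have := huniq.eq_deriv _ hd hd'
    rw [hyT, hlT] at this
    simpa using this
  have := hQ.dotProduct_mulVec_pos hv0
  rw [star_trivial, hQv] at this
  exact lt_irrefl _ this

lemma hamRiccati_terminal : hamRiccati T A S Q T = 0 := by
  simp [hamRiccati, hamCostate_terminal]

open scoped Matrix.Norms.Operator in
-- The product rule for `P = L Y⁻¹` gives `P' = L' Y⁻¹ - P Y' Y⁻¹`; inserting the linear equations
-- for `Y` and `L` turns this into the quadratic equation.
lemma hasDerivAt_hamRiccati (hS : S.PosSemidef) (hQ : Q.PosDef) (t : ℝ) (i j : Fin n) :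
    HasDerivAt (fun s ↦ hamRiccati T A S Q s i j)
      ((-(Aᵀ * hamRiccati T A S Q t + hamRiccati T A S Q t * A
        - hamRiccati T A S Q t * S * hamRiccati T A S Q t + Q)) i j) t := by
  refine hasDerivAt_apply_of_hasDerivAt (M := hamRiccati T A S Q) ?_ i j
  have hu := isUnit_hamState (T := T) (A := A) hS hQ t
  refine ((hasDerivAt_hamCostate_matrix T A S Q t).mul (hasDerivAt_inv_matrix
    (hasDerivAt_hamState_matrix T A S Q t) hu)).congr_deriv ?_
  rw [hamRiccati]
  have h1 : hamState T A S Q t * (hamState T A S Q t)⁻¹ = 1 :=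
    Matrix.mul_nonsing_inv _ ((Matrix.isUnit_iff_isUnit_det _).1 hu)
  generalize hamState T A S Q t = Y at *
  generalize hamCostate T A S Q t = L at *
  have e1 : Q * Y * Y⁻¹ = Q := by rw [Matrix.mul_assoc, h1, Matrix.mul_one]
  have e2 : A * Y * Y⁻¹ = A := by rw [Matrix.mul_assoc, h1, Matrix.mul_one]
  rw [Matrix.sub_mul, Matrix.neg_mul, e1, Matrix.mul_assoc Y⁻¹, Matrix.sub_mul, e2]
  noncomm_ring

lemma continuous_hamRiccati {X : Type*} [TopologicalSpace X] {A S : X → Matrix (Fin n) (Fin n) ℝ}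
    (hA : Continuous A) (hSc : Continuous S) (hS : ∀ x, (S x).PosSemidef) (hQ : Q.PosDef) :
    Continuous fun p : X × ℝ ↦ hamRiccati T (A p.1) (S p.1) Q p.2 := by
  have hf : Continuous fun p : X × ℝ ↦ hamFlow T (A p.1) (S p.1) Q p.2 :=
    (continuous_hamFlow T Q).comp (((hA.comp continuous_fst).prodMk
      (hSc.comp continuous_fst)).prodMk continuous_snd)
  have hY : Continuous fun p : X × ℝ ↦ hamState T (A p.1) (S p.1) Q p.2 :=
    hf.matrix_submatrix Sum.inl Sum.inl
  have hL : Continuous fun p : X × ℝ ↦ hamCostate T (A p.1) (S p.1) Q p.2 :=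
    hf.matrix_submatrix Sum.inr Sum.inl
  refine hL.matrix_mul ?_
  -- As inverse determinant times adjugate, the inverse is continuous wherever the determinant does
  -- not vanish.
  simp only [Matrix.inv_def, Ring.inverse_eq_inv']
  refine (hY.matrix_det.inv₀ fun p ↦ ?_).smul hY.matrix_adjugate
  have := isUnit_hamState (T := T) (A := A p.1) (hS p.1) hQ p.2
  rw [Matrix.isUnit_iff_isUnit_det, isUnit_iff_ne_zero] at this
  exact this

/-- For any solution `P`, the defect `E = L - P Y` solves the linear equation `E' = (P S - Aᵀ) E`
with `E(T) = 0`, so it vanishes and `P = L Y⁻¹`. The quadratic equation is thus never compared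
directly, and symmetry of `P` plays no role. -/
lemma eqOn_hamRiccati {P : ℝ → Matrix (Fin n) (Fin n) ℝ} (hS : S.PosSemidef) (hQ : Q.PosDef)
    (hP : ∀ t ∈ Icc 0 T, ∀ i j, HasDerivWithinAt (fun s ↦ P s i j)
      ((-(Aᵀ * P t + P t * A - P t * S * P t + Q)) i j) (Icc 0 T) t)
    (hPT : P T = 0) : EqOn P (hamRiccati T A S Q) (Icc 0 T) := by
  set Y := hamState T A S Q with hY
  set L := hamCostate T A S Q with hL
  set M : ℝ → Matrix (Fin n) (Fin n) ℝ := fun t ↦ P t * S - Aᵀ with hM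
  have hPc : ContinuousOn P (Icc 0 T) :=
    continuousOn_pi.2 fun i ↦ continuousOn_pi.2 fun j t ht ↦ (hP t ht i j).continuousWithinAt
  have hMc : ContinuousOn (fun t ↦ absSum (M t)) (Icc 0 T) :=
    continuous_absSum.comp_continuousOn <| ContinuousOn.sub
      (by
        refine continuousOn_pi.2 fun i ↦ continuousOn_pi.2 fun j ↦ ?_
        simp only [Matrix.mul_apply]
        have h1 := fun i j ↦ continuousOn_pi.1 (continuousOn_pi.1 hPc i) j
        fun_prop) continuousOn_const
  obtain ⟨K, hK⟩ := isCompact_Icc.bddAbove_image hMc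
  have hE : ∀ t ∈ Icc 0 T, L t - P t * Y t = 0 := by
    intro t ht
    refine Matrix.ext_col fun j ↦ ?_
    have hd : ∀ t ∈ Icc 0 T, HasDerivWithinAt (fun s ↦ (L s - P s * Y s).col j)
        (M t *ᵥ (L t - P t * Y t).col j) (Icc 0 T) t := by
      intro t ht
      rw [hasDerivWithinAt_pi]
      intro i
      have h1 := (hasDerivAt_hamCostate (T := T) (A := A) (S := S) (Q := Q) t i j).hasDerivWithinAt
        (s := Icc 0 T)
      have h2 := hasDerivWithinAt_matrix_mul
        (M' := fun t ↦ (-(Aᵀ * P t + P t * A - P t * S * P t + Q)))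
        (N := Y) (N' := fun t ↦ A * Y t - S * L t) (hP t ht) (fun i j ↦
        (hasDerivAt_hamState (T := T) (A := A) (S := S) (Q := Q) t i j).hasDerivWithinAt
        (s := Icc 0 T)) i j
      refine (h1.sub h2).congr_deriv ?_
      change _ = (M t * (L t - P t * Y t)) i j
      rw [← Matrix.sub_apply, ← hY, ← hL]
      refine congrFun (congrFun ?_ i) j
      simp only [hM]
      noncomm_ring
    -- Uniqueness runs backwards from the terminal time, column by column, against the zero
    -- solution.
    have := ODE_solution_unique_of_mem_Icc_left (a := 0) (b := T) (K := K.toNNReal)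
      (s := fun _ ↦ univ) (v := fun t x ↦ M t *ᵥ x) (f := fun s ↦ (L s - P s * Y s).col j)
      (g := fun _ ↦ 0) ?_ (fun t ht ↦ (hd t ht).continuousWithinAt)
      (fun t ht ↦ (hd t (Ioc_subset_Icc_self ht)).mono_of_mem_nhdsWithin
        (Icc_mem_nhdsLE_of_mem ht)) (fun _ _ ↦ mem_univ _) continuousOn_const
      (fun t _ ↦ by simpa using hasDerivWithinAt_const t (Iic t) (0 : Fin n → ℝ))
      (fun _ _ ↦ mem_univ _) ?_ ht
    · exact this
    · intro t ht
      refine LipschitzOnWith.of_dist_le_mul fun x _ y _ ↦ ?_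
      rw [dist_eq_norm, dist_eq_norm, ← Matrix.mulVec_sub]
      refine (norm_mulVec_le _ _).trans ?_
      gcongr
      exact (hK ⟨t, Ioc_subset_Icc_self ht, rfl⟩).trans (Real.le_coe_toNNReal K)
    · simp [hPT, hL, hamCostate_terminal]
      rfl
  intro t ht
  have hu := (Matrix.isUnit_iff_isUnit_det _).1 (isUnit_hamState (T := T) (A := A) hS hQ t)
  rw [hamRiccati, ← hL, ← hY, sub_eq_zero.1 (hE t ht), Matrix.mul_assoc, Matrix.mul_nonsing_inv _ hu,
    Matrix.mul_one]

end riccati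

end

/-! ### The feedback gain -/

section

variable {n d : ℕ}

section gain

/-- The gain matrix computed from the Hamiltonian flow. -/
def hamGain (T : ℝ) (Q : Matrix (Fin n) (Fin n) ℝ) (R : Matrix (Fin d) (Fin d) ℝ)
    (θ : Matrix (Fin n ⊕ Fin d) (Fin n) ℝ) (t : ℝ) : Matrix (Fin d) (Fin n) ℝ :=
  -(R⁻¹ * (paramB θ)ᵀ * hamRiccati T (paramA θ) (paramB θ * R⁻¹ * (paramB θ)ᵀ) Q t)

variable {T : ℝ} {Q : Matrix (Fin n) (Fin n) ℝ} {R : Matrix (Fin d) (Fin d) ℝ}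

lemma posSemidef_inputWeight (hR : R.PosDef) (B : Matrix (Fin n) (Fin d) ℝ) :
    (B * R⁻¹ * Bᵀ).PosSemidef := by
  simpa using hR.inv.posSemidef.mul_mul_conjTranspose_same B

lemma isRiccatiSolution_hamRiccati (hQ : Q.PosDef) (hR : R.PosDef)
    (A : Matrix (Fin n) (Fin n) ℝ) (B : Matrix (Fin n) (Fin d) ℝ) :
    IsRiccatiSolution T Q R A B (hamRiccati T A (B * R⁻¹ * Bᵀ) Q) where
  deriv_eq t _ i j := (hasDerivAt_hamRiccati (posSemidef_inputWeight hR B) hQ t i j).hasDerivWithinAt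
  terminal := hamRiccati_terminal

lemma isRiccatiSolution_riccati (hQ : Q.PosDef) (hR : R.PosDef)
    (θ : Matrix (Fin n ⊕ Fin d) (Fin n) ℝ) :
    IsRiccatiSolution T Q R (paramA θ) (paramB θ) (riccati T Q R θ) := by
  have h : ∃ P, IsRiccatiSolution T Q R (paramA θ) (paramB θ) P :=
    ⟨_, isRiccatiSolution_hamRiccati hQ hR _ _⟩
  rw [riccati, dif_pos h]
  exact h.choose_spec

lemma IsRiccatiSolution.eqOn_hamRiccati {A : Matrix (Fin n) (Fin n) ℝ}
    {B : Matrix (Fin n) (Fin d) ℝ} {P : ℝ → Matrix (Fin n) (Fin n) ℝ}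
    (hP : IsRiccatiSolution T Q R A B P) (hQ : Q.PosDef) (hR : R.PosDef) :
    EqOn P (hamRiccati T A (B * R⁻¹ * Bᵀ) Q) (Icc 0 T) :=
  LQRL.eqOn_hamRiccati (posSemidef_inputWeight hR B) hQ hP.deriv_eq hP.terminal

lemma gain_eq_hamGain (hQ : Q.PosDef) (hR : R.PosDef) (θ : Matrix (Fin n ⊕ Fin d) (Fin n) ℝ)
    {t : ℝ} (ht : t ∈ Icc 0 T) : gain T Q R θ t = hamGain T Q R θ t := by
  rw [gain, hamGain, (isRiccatiSolution_riccati hQ hR θ).eqOn_hamRiccati hQ hR ht]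

lemma continuous_hamGain (hQ : Q.PosDef) (hR : R.PosDef) :
    Continuous fun p : Matrix (Fin n ⊕ Fin d) (Fin n) ℝ × ℝ ↦ hamGain T Q R p.1 p.2 := by
  have hA : Continuous (paramA : Matrix (Fin n ⊕ Fin d) (Fin n) ℝ → _) :=
    (continuous_id.matrix_submatrix Sum.inl id).matrix_transpose
  have hB : Continuous (paramB : Matrix (Fin n ⊕ Fin d) (Fin n) ℝ → _) :=
    (continuous_id.matrix_submatrix Sum.inr id).matrix_transpose
  have hS : Continuous fun θ : Matrix (Fin n ⊕ Fin d) (Fin n) ℝ ↦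
      paramB θ * R⁻¹ * (paramB θ)ᵀ :=
    (hB.matrix_mul continuous_const).matrix_mul hB.matrix_transpose
  exact ((continuous_const.matrix_mul (hB.comp continuous_fst).matrix_transpose).matrix_mul
    (continuous_hamRiccati hA hS (fun θ ↦ posSemidef_inputWeight hR (paramB θ)) hQ)).neg

lemma hamGain_terminal (θ : Matrix (Fin n ⊕ Fin d) (Fin n) ℝ) : hamGain T Q R θ T = 0 := by
  simp [hamGain, hamRiccati_terminal]

/-- Before `T` only differentiability of the gain matters. At `T` the Riccati equation with `P_T =
0` reads `P'_T = -Q`, which gives the explicit value; this is how the rank of `B` enters. -/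
lemma hasDerivAt_hamGain (hQ : Q.PosDef) (hR : R.PosDef) (θ : Matrix (Fin n ⊕ Fin d) (Fin n) ℝ)
    (t : ℝ) : ∃ K' : Matrix (Fin d) (Fin n) ℝ,
      (∀ i j, HasDerivAt (fun s ↦ hamGain T Q R θ s i j) (K' i j) t) ∧
      (t = T → K' = R⁻¹ * (paramB θ)ᵀ * Q) := by
  set A := paramA θ
  set S := paramB θ * R⁻¹ * (paramB θ)ᵀ with hS
  have h := hasDerivAt_hamRiccati (T := T) (A := A) (posSemidef_inputWeight hR (paramB θ)) hQ t
  rw [← hS] at h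
  set P := hamRiccati T A S Q with hP
  refine ⟨-(R⁻¹ * (paramB θ)ᵀ * -(Aᵀ * P t + P t * A - P t * S * P t + Q)), fun i j ↦ ?_, ?_⟩
  · have := hasDerivWithinAt_matrix_mul (s := univ) (M := fun _ ↦ R⁻¹ * (paramB θ)ᵀ)
      (M' := fun _ ↦ 0) (N' := fun t ↦ -(Aᵀ * P t + P t * A - P t * S * P t + Q))
      (fun i j ↦ by simpa using hasDerivWithinAt_const t univ _)
      (fun i j ↦ (h i j).hasDerivWithinAt) i j
    rw [hasDerivWithinAt_univ, Matrix.zero_mul, zero_add] at this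
    exact this.neg
  · rintro rfl
    simp [hP, hamRiccati_terminal]

end gain

/-! ### Brownian paths, filtration and increments -/

section brownian

variable {Ω : Type*} {mΩ : MeasurableSpace Ω} {μ : Measure Ω} {W : ℝ≥0 → Ω → Fin n → ℝ}

open Classical in
/-- A modification of `W` all of whose paths are continuous. -/
def brownianPath (W : ℝ≥0 → Ω → Fin n → ℝ) (t : ℝ) (ω : Ω) : Fin n → ℝ :=
  if Continuous fun s ↦ W s ω then W t.toNNReal ω else 0

lemma continuous_brownianPath (ω : Ω) : Continuous fun t ↦ brownianPath W t ω := by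
  unfold brownianPath
  split_ifs with h
  · exact h.comp continuous_real_toNNReal
  · exact continuous_const

lemma IsStandardBrownian.ae_continuous (hW : IsStandardBrownian W μ) :
    ∀ᵐ ω ∂μ, Continuous fun t ↦ W t ω := by
  filter_upwards [ae_all_iff.2 fun i ↦ (hW.coord i).cont] with ω hω
  exact continuous_pi hω

lemma IsStandardBrownian.ae_brownianPath_eq (hW : IsStandardBrownian W μ) :
    ∀ᵐ ω ∂μ, ∀ t, brownianPath W t ω = W t.toNNReal ω := by
  filter_upwards [hW.ae_continuous] with ω hω t
  simp [brownianPath, hω]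

/-- The coordinates are a priori only almost everywhere measurable; completeness of `μ` upgrades
this. -/
lemma IsStandardBrownian.measurable [μ.IsComplete] (hW : IsStandardBrownian W μ) (t : ℝ≥0) :
    Measurable (W t) :=
  measurable_pi_iff.2 fun i ↦
    ((hW.coord i).toIsPreBrownianReal.aemeasurable t).nullMeasurable.measurable_of_complete

lemma brownianSigma_le [μ.IsComplete] (hW : IsStandardBrownian W μ) (t : ℝ≥0) :
    brownianSigma W μ t ≤ mΩ :=
  sup_le (iSup_le fun s ↦ (hW.measurable s).comap_le)
    (MeasurableSpace.generateFrom_le fun _ hN ↦ measurableSet_of_null hN)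

lemma brownianSigma_mono {s t : ℝ≥0} (hst : s ≤ t) : brownianSigma W μ s ≤ brownianSigma W μ t := by
  refine sup_le_sup_right (iSup_le fun r ↦ ?_) _
  exact le_iSup (fun r : Iic t ↦ MeasurableSpace.comap (W r) inferInstance)
    ⟨r, (mem_Iic.1 r.2).trans hst⟩

lemma measurable_brownianSigma (t : ℝ≥0) : Measurable[brownianSigma W μ t] (W t) := by
  rw [measurable_iff_comap_le]
  exact (le_iSup (fun r : Iic t ↦ MeasurableSpace.comap (W r) inferInstance)
    ⟨t, mem_Iic.2 le_rfl⟩).trans le_sup_left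

/-- The set of discontinuous paths is null, hence belongs to every `ℱ_t` of the augmented
filtration, so redefining the paths there preserves adaptedness. -/
lemma IsStandardBrownian.measurable_brownianPath (hW : IsStandardBrownian W μ) (t : ℝ) :
    Measurable[brownianSigma W μ t.toNNReal] (brownianPath W t) := by
  have hs : MeasurableSet[brownianSigma W μ t.toNNReal] {ω | Continuous fun s ↦ W s ω} := by
    have : MeasurableSet[brownianSigma W μ t.toNNReal] {ω | Continuous fun s ↦ W s ω}ᶜ :=
      le_sup_right (a := ⨆ s : Iic t.toNNReal, MeasurableSpace.comap (W s) inferInstance) _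
        (MeasurableSpace.measurableSet_generateFrom hW.ae_continuous)
    simpa using this.compl
  exact Measurable.ite hs (measurable_brownianSigma _) measurable_const

lemma IsStandardBrownian.hasLaw_sub (hW : IsStandardBrownian W μ) {s t : ℝ} (hs : 0 ≤ s)
    (hst : s ≤ t) (i : Fin n) :
    HasLaw (fun ω ↦ brownianPath W t ω i - brownianPath W s ω i)
      (gaussianReal 0 (t - s).toNNReal) μ := by
  have h := (hW.coord i).toIsPreBrownianReal.hasLaw_sub t.toNNReal s.toNNReal
  have e : nndist (t.toNNReal : ℝ) (s.toNNReal : ℝ) = (t - s).toNNReal := by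
    rw [Real.coe_toNNReal _ hs, Real.coe_toNNReal _ (hs.trans hst)]
    ext
    rw [coe_nndist, Real.dist_eq, abs_of_nonneg (sub_nonneg.2 hst),
      Real.coe_toNNReal _ (sub_nonneg.2 hst)]
  erw [e] at h
  refine h.congr ?_
  filter_upwards [hW.ae_brownianPath_eq] with ω hω
  simp [hω]

lemma memLp_of_hasLaw_gaussian {X : Ω → ℝ} {v : ℝ≥0} (h : HasLaw X (gaussianReal 0 v) μ) :
    MemLp X 2 μ := by
  have := memLp_id_gaussianReal (μ := 0) (v := v) 2
  rw [← h.map_eq] at this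
  exact (memLp_map_measure_iff (by fun_prop) h.aemeasurable).1 this

/-- The coordinate increments are centred and independent, so their variances add. This exact linear
growth in `t - s` is the only quantitative form of nondegeneracy used. -/
lemma IsStandardBrownian.integral_sq_dotProduct_sub [IsProbabilityMeasure μ]
    (hW : IsStandardBrownian W μ) {s t : ℝ}
    (hs : 0 ≤ s) (hst : s ≤ t) (c : Fin n → ℝ) :
    Integrable (fun ω ↦ (c ⬝ᵥ (brownianPath W t ω - brownianPath W s ω)) ^ 2) μ ∧
      ∫ ω, (c ⬝ᵥ (brownianPath W t ω - brownianPath W s ω)) ^ 2 ∂μ = (c ⬝ᵥ c) * (t - s) := by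
  set D : Fin n → Ω → ℝ := fun i ω ↦ c i * (brownianPath W t ω i - brownianPath W s ω i) with hD
  have hL := fun i ↦ memLp_of_hasLaw_gaussian (hW.hasLaw_sub hs hst i)
  have hDL : ∀ i, MemLp (D i) 2 μ := fun i ↦ (hL i).const_mul (c i)
  have hsum : (fun ω ↦ c ⬝ᵥ (brownianPath W t ω - brownianPath W s ω)) = ∑ i, D i := by
    ext ω
    simp [dotProduct, hD]
  have hmem : MemLp (fun ω ↦ c ⬝ᵥ (brownianPath W t ω - brownianPath W s ω)) 2 μ := by
    rw [hsum]
    exact memLp_finsetSum' _ fun i _ ↦ hDL i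
  refine ⟨hmem.integrable_sq, ?_⟩
  have hmean : ∀ i, ∫ ω, D i ω ∂μ = 0 := fun i ↦ by
    rw [hD, integral_const_mul, (hW.hasLaw_sub hs hst i).integral_eq, integral_id_gaussianReal,
      mul_zero]
  have hvar : ∀ i, Var[D i; μ] = c i ^ 2 * (t - s) := fun i ↦ by
    rw [hD, variance_const_mul, (hW.hasLaw_sub hs hst i).variance_eq, variance_id_gaussianReal,
      Real.coe_toNNReal _ (sub_nonneg.2 hst)]
  have hind : ∀ i j, i ≠ j → IndepFun (D i) (D j) μ := by
    intro i j hij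
    have h := (hW.indep.indepFun hij).comp
      (φ := fun w : ℝ≥0 → ℝ ↦ c i * (w t.toNNReal - w s.toNNReal))
      (ψ := fun w : ℝ≥0 → ℝ ↦ c j * (w t.toNNReal - w s.toNNReal)) (by fun_prop) (by fun_prop)
    refine h.congr ?_ ?_ <;>
    · filter_upwards [hW.ae_brownianPath_eq] with ω hω
      simp [hD, hω]
  have hmean0 : ∫ ω, c ⬝ᵥ (brownianPath W t ω - brownianPath W s ω) ∂μ = 0 := by
    have : (fun ω ↦ c ⬝ᵥ (brownianPath W t ω - brownianPath W s ω)) = fun ω ↦ ∑ i, D i ω := by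
      ext ω
      simp [dotProduct, hD]
    rw [this, integral_finsetSum _ fun i _ ↦ (hDL i).integrable (by simp)]
    simp [hmean]
  rw [← variance_of_integral_eq_zero hmem.aemeasurable hmean0, hsum,
    IndepFun.variance_sum (fun i _ ↦ hDL i) (fun i _ j _ hij ↦ hind i j hij)]
  simp [hvar, dotProduct, Finset.sum_mul, sq]

lemma IsStandardBrownian.ae_brownianPath_zero (hW : IsStandardBrownian W μ) :
    ∀ᵐ ω ∂μ, brownianPath W 0 ω = 0 := by
  filter_upwards [hW.ae_brownianPath_eq,
    ae_all_iff.2 fun i ↦ (hW.coord i).toIsPreBrownianReal.eval_zero_ae_eq_zero] with ω h h0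
  rw [h]
  ext i
  simpa using h0 i

end brownian

end

/-! ### Pathwise linear equations with additive noise -/

section

variable {n d : ℕ}

/-- `x` solves `dx = F x dt + dw`, `x(0) = x₀ + w(0)` on `[0, T]`. -/
structure IsLinearPath (T : ℝ) (x₀ : Fin n → ℝ) (F : ℝ → Matrix (Fin n) (Fin n) ℝ)
    (w x : ℝ → Fin n → ℝ) : Prop where
  continuousOn : ContinuousOn x (Icc 0 T)
  integral_eq : ∀ t ∈ Icc 0 T, x t = x₀ + (∫ s in (0 : ℝ)..t, F s *ᵥ x s) + w t

section path

variable {T : ℝ} {x₀ : Fin n → ℝ} {F F' : ℝ → Matrix (Fin n) (Fin n) ℝ} {w x x' : ℝ → Fin n → ℝ}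

lemma continuousOn_mulVec (hF : Continuous F) {s : Set ℝ} (hx : ContinuousOn x s) :
    ContinuousOn (fun s ↦ F s *ᵥ x s) s := by
  refine continuousOn_pi.2 fun i ↦ ?_
  simp only [Matrix.mulVec, dotProduct]
  have h1 := fun j ↦ continuousOn_pi.1 hx j
  have h2 := fun i j ↦ hF.matrix_elem i j
  fun_prop

lemma uIcc_subset_Icc_of_mem {t : ℝ} (ht : t ∈ Icc 0 T) : uIcc 0 t ⊆ Icc 0 T := by
  rw [uIcc_of_le ht.1]
  exact Icc_subset_Icc_right ht.2

lemma intervalIntegrable_of_continuousOn {E : Type*} [NormedAddCommGroup E] {f : ℝ → E}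
    (hf : ContinuousOn f (Icc 0 T)) {t : ℝ} (ht : t ∈ Icc 0 T) :
    IntervalIntegrable f volume 0 t :=
  (hf.mono (uIcc_subset_Icc_of_mem ht)).intervalIntegrable

lemma integral_le_integral_of_mem {f : ℝ → ℝ} (hf : ContinuousOn f (Icc 0 T))
    (hf0 : ∀ s ∈ Icc 0 T, 0 ≤ f s) {t : ℝ} (ht : t ∈ Icc 0 T) :
    ∫ s in (0 : ℝ)..t, f s ≤ ∫ s in (0 : ℝ)..T, f s := by
  have hT : T ∈ Icc 0 T := right_mem_Icc.2 (ht.1.trans ht.2)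
  refine intervalIntegral.integral_mono_interval le_rfl ht.1 ht.2 ?_
    (intervalIntegrable_of_continuousOn hf hT)
  filter_upwards [ae_restrict_mem measurableSet_Ioc] with s hs
  exact hf0 s (Ioc_subset_Icc_self hs)

/-- Stability of linear equations with respect to the coefficients. -/
lemma IsLinearPath.norm_sub_le (hF : Continuous F) (hF' : Continuous F')
    (hx : IsLinearPath T x₀ F w x) (hx' : IsLinearPath T x₀ F' w x') {L : ℝ} (hL0 : 0 ≤ L)
    (hL : ∀ t ∈ Icc 0 T, absSum (F t) ≤ L) {t : ℝ} (ht : t ∈ Icc 0 T) :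
    ‖x t - x' t‖ ≤ (∫ s in (0 : ℝ)..T, ‖(F s - F' s) *ᵥ x' s‖) * Real.exp (L * T) := by
  have hT : 0 ≤ T := ht.1.trans ht.2
  have hg : ContinuousOn (fun s ↦ (F s - F' s) *ᵥ x' s) (Icc 0 T) :=
    continuousOn_mulVec (hF.sub hF') hx'.continuousOn
  have hxx : ContinuousOn (fun s ↦ x s - x' s) (Icc 0 T) := hx.continuousOn.sub hx'.continuousOn
  have hFx := continuousOn_mulVec hF hxx
  refine le_mul_exp_of_le_integral (φ := fun t ↦ ‖x t - x' t‖) hxx.norm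
    (fun _ _ ↦ norm_nonneg _)
    (intervalIntegral.integral_nonneg hT fun _ _ ↦ norm_nonneg _) hL0 (fun t ht ↦ ?_) t ht
  -- The noise cancels, and the coefficient difference acts only on `x'`, so `x'` can stay fixed
  -- while `F` varies.
  have e : x t - x' t = (∫ s in (0 : ℝ)..t, (F s - F' s) *ᵥ x' s)
      + ∫ s in (0 : ℝ)..t, F s *ᵥ (x s - x' s) := by
    rw [hx.integral_eq t ht, hx'.integral_eq t ht, ← intervalIntegral.integral_add
      (intervalIntegrable_of_continuousOn hg ht) (intervalIntegrable_of_continuousOn hFx ht)]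
    rw [add_sub_add_right_eq_sub, add_sub_add_left_eq_sub, ← intervalIntegral.integral_sub
      (intervalIntegrable_of_continuousOn (continuousOn_mulVec hF hx.continuousOn) ht)
      (intervalIntegrable_of_continuousOn (continuousOn_mulVec hF' hx'.continuousOn) ht)]
    congr 1
    ext s
    simp [Matrix.sub_mulVec, Matrix.mulVec_sub]
  rw [e]
  refine (norm_add_le _ _).trans (add_le_add ?_ ?_)
  · refine (intervalIntegral.norm_integral_le_integral_norm ht.1).trans ?_
    exact integral_le_integral_of_mem hg.norm (fun _ _ ↦ norm_nonneg _) ht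
  · refine (intervalIntegral.norm_integral_le_integral_norm ht.1).trans ?_
    refine intervalIntegral.integral_mono_on ht.1
      (intervalIntegrable_of_continuousOn hFx.norm ht)
      (intervalIntegrable_of_continuousOn (continuousOn_const.mul hxx.norm) ht) fun s hs ↦ ?_
    refine (norm_mulVec_le _ _).trans ?_
    gcongr
    exact hL s ⟨hs.1, hs.2.trans ht.2⟩

lemma IsLinearPath.eqOn (hF : Continuous F) (hx : IsLinearPath T x₀ F w x)
    (hx' : IsLinearPath T x₀ F w x') : EqOn x x' (Icc 0 T) := by
  intro t ht
  obtain ⟨L, hL0, hL⟩ := exists_absSum_le hF T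
  have := hx.norm_sub_le hF hF hx' hL0 hL ht
  simp only [sub_self, Matrix.zero_mulVec, norm_zero, intervalIntegral.integral_zero,
    zero_mul] at this
  exact sub_eq_zero.1 (norm_le_zero_iff.1 this)

/-- Grönwall is applied to `x - w`, with `‖F x‖ ≤ L ‖w‖ + L ‖x - w‖`; the noise then enters the
constant only through its integral over `[0, T]`. -/
lemma IsLinearPath.norm_le (hF : Continuous F) (hw : Continuous w)
    (hx : IsLinearPath T x₀ F w x) {L : ℝ} (hL0 : 0 ≤ L)
    (hL : ∀ t ∈ Icc 0 T, absSum (F t) ≤ L) {t : ℝ} (ht : t ∈ Icc 0 T) :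
    ‖x t‖ ≤ ‖w t‖ + (‖x₀‖ + L * ∫ s in (0 : ℝ)..T, ‖w s‖) * Real.exp (L * T) := by
  have hT : 0 ≤ T := ht.1.trans ht.2
  have hy : ContinuousOn (fun s ↦ x s - w s) (Icc 0 T) := hx.continuousOn.sub hw.continuousOn
  have key := le_mul_exp_of_le_integral (φ := fun t ↦ ‖x t - w t‖)
    (G := ‖x₀‖ + L * ∫ s in (0 : ℝ)..T, ‖w s‖) (L := L) hy.norm (fun _ _ ↦ norm_nonneg _)
    (add_nonneg (norm_nonneg _) (mul_nonneg hL0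
      (intervalIntegral.integral_nonneg hT fun _ _ ↦ norm_nonneg _))) hL0 (fun t ht ↦ ?_) t ht
  · have h1 := norm_add_le (x t - w t) (w t)
    rw [sub_add_cancel] at h1
    linarith
  rw [hx.integral_eq t ht, add_sub_cancel_right, add_assoc]
  refine (norm_add_le _ _).trans (add_le_add le_rfl ?_)
  refine (intervalIntegral.norm_integral_le_integral_norm ht.1).trans ?_
  have h1 : ∫ s in (0 : ℝ)..t, ‖F s *ᵥ x s‖ ≤
      ∫ s in (0 : ℝ)..t, (L * ‖w s‖ + L * ‖x s - w s‖) := by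
    refine intervalIntegral.integral_mono_on ht.1
      (intervalIntegrable_of_continuousOn (continuousOn_mulVec hF hx.continuousOn).norm ht)
      (intervalIntegrable_of_continuousOn (by fun_prop) ht) fun s hs ↦ ?_
    refine (norm_mulVec_le _ _).trans ?_
    rw [← mul_add]
    have h2 := norm_add_le (x s - w s) (w s)
    rw [sub_add_cancel, add_comm] at h2
    exact mul_le_mul (hL s ⟨hs.1, hs.2.trans ht.2⟩) h2 (norm_nonneg _) hL0
  rw [intervalIntegral.integral_add (intervalIntegrable_of_continuousOn (by fun_prop) ht)
    (intervalIntegrable_of_continuousOn (by fun_prop) ht),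
    intervalIntegral.integral_const_mul] at h1
  refine h1.trans ?_
  gcongr
  exact integral_le_integral_of_mem hw.norm.continuousOn (fun _ _ ↦ norm_nonneg _) ht

/-- The constant in the quadratic growth bound for linear equations. -/
def growthConst (T L : ℝ) (x₀ : Fin n → ℝ) : ℝ :=
  2 + 4 * Real.exp (L * T) ^ 2 * (‖x₀‖ ^ 2 + L ^ 2 * T)

lemma growthConst_nonneg (hT : 0 ≤ T) (L : ℝ) (x₀ : Fin n → ℝ) : 0 ≤ growthConst T L x₀ := by
  unfold growthConst; positivity

/-- This squares the linear bound, with Cauchy–Schwarz for `(∫ ‖w‖)²`. The constant depends on `F`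
only through `L`, so one right-hand side dominates the solutions for all nearby parameters. -/
lemma IsLinearPath.sq_norm_le (hF : Continuous F) (hw : Continuous w)
    (hx : IsLinearPath T x₀ F w x) {L : ℝ} (hL0 : 0 ≤ L)
    (hL : ∀ t ∈ Icc 0 T, absSum (F t) ≤ L) {t : ℝ} (ht : t ∈ Icc 0 T) :
    ‖x t‖ ^ 2 ≤ growthConst T L x₀ * (1 + ‖w t‖ ^ 2 + ∫ s in (0 : ℝ)..T, ‖w s‖ ^ 2) := by
  have hT : 0 ≤ T := ht.1.trans ht.2
  have h := hx.norm_le hF hw hL0 hL ht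
  set m := ∫ s in (0 : ℝ)..T, ‖w s‖ with hm
  set J := ∫ s in (0 : ℝ)..T, ‖w s‖ ^ 2 with hJ
  set e := Real.exp (L * T) with he
  have hJ0 : 0 ≤ J := intervalIntegral.integral_nonneg hT fun _ _ ↦ sq_nonneg _
  have hmJ : m ^ 2 ≤ T * J := by
    simpa using sq_intervalIntegral_le hT hw.norm.continuousOn
  have h1 : ‖x t‖ ^ 2 ≤ 2 * ‖w t‖ ^ 2 + 2 * (2 * ‖x₀‖ ^ 2 + 2 * (L ^ 2 * m ^ 2)) * e ^ 2 := by
    calc ‖x t‖ ^ 2 ≤ (‖w t‖ + (‖x₀‖ + L * m) * e) ^ 2 := by gcongr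
      _ ≤ 2 * ‖w t‖ ^ 2 + 2 * ((‖x₀‖ + L * m) * e) ^ 2 := by
          nlinarith [sq_nonneg (‖w t‖ - (‖x₀‖ + L * m) * e)]
      _ ≤ _ := by
          rw [mul_pow, ← mul_assoc]
          gcongr
          nlinarith [sq_nonneg (‖x₀‖ - L * m)]
  have h2 : L ^ 2 * m ^ 2 ≤ L ^ 2 * (T * J) := by gcongr
  have h3 : ‖x t‖ ^ 2 ≤ 2 * ‖w t‖ ^ 2 + 2 * (2 * ‖x₀‖ ^ 2 + 2 * (L ^ 2 * (T * J))) * e ^ 2 :=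
    h1.trans (by gcongr)
  refine h3.trans ?_
  have p1 : 0 ≤ e ^ 2 * ‖x₀‖ ^ 2 := by positivity
  have p2 : 0 ≤ e ^ 2 * (L ^ 2 * T) := by positivity
  have p3 : 0 ≤ ‖w t‖ ^ 2 := by positivity
  have q1 := mul_nonneg p1 p3
  have q2 := mul_nonneg p2 p3
  have q3 := mul_nonneg p1 hJ0
  have q4 := mul_nonneg p2 hJ0
  have e1 : growthConst T L x₀ = 2 + 4 * (e ^ 2 * ‖x₀‖ ^ 2) + 4 * (e ^ 2 * (L ^ 2 * T)) := by
    rw [growthConst, ← he]; ring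
  rw [e1]
  nlinarith

end path

/-! ### Existence of adapted solutions -/

section existence

lemma measurable_intervalIntegral_of_continuous {Ω : Type*} {m : MeasurableSpace Ω}
    {u : ℝ → Ω → Fin n → ℝ} (hc : ∀ ω, Continuous fun s ↦ u s ω) (hm : ∀ s, Measurable (u s))
    {a b : ℝ} (hab : a ≤ b) : Measurable fun ω ↦ ∫ s in a..b, u s ω := by
  simp only [intervalIntegral.integral_of_le hab]
  have h := (measurable_uncurry_of_continuous_of_measurable hc hm).stronglyMeasurable
  exact (h.comp_measurable measurable_swap).integral_prod_right'.measurable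

lemma measurable_mulVec {Ω ι : Type*} [Finite ι] {m : MeasurableSpace Ω} (M : Matrix ι (Fin n) ℝ)
    {u : Ω → Fin n → ℝ} (hu : Measurable u) : Measurable fun ω ↦ M *ᵥ u ω := by
  refine measurable_pi_iff.2 fun i ↦ ?_
  simp only [Matrix.mulVec, dotProduct]
  fun_prop

lemma measurable_mulVec_const_add_add {Ω : Type*} {m : MeasurableSpace Ω}
    (M : Matrix (Fin n) (Fin n) ℝ) (x₀ : Fin n → ℝ) {u v : Ω → Fin n → ℝ} (hu : Measurable u)
    (hv : Measurable v) : Measurable fun ω ↦ M *ᵥ (x₀ + u ω) + v ω :=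
  (measurable_mulVec M (hu.const_add x₀)).add hv

variable {Ω : Type*} {mΩ : MeasurableSpace Ω} {μ : Measure Ω} {W : ℝ≥0 → Ω → Fin n → ℝ}
  {T : ℝ} {F : ℝ → Matrix (Fin n) (Fin n) ℝ}

/-- Existence of strong solutions of linear equations with additive noise. -/
lemma IsStandardBrownian.exists_linearProcess (hW : IsStandardBrownian W μ) (hT : 0 ≤ T)
    (x₀ : Fin n → ℝ) (hF : Continuous F) :
    ∃ X : ℝ → Ω → Fin n → ℝ,
      (∀ t ∈ Icc 0 T, Measurable[brownianSigma W μ t.toNNReal] (X t)) ∧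
      (∀ ω, Continuous fun t ↦ X t ω) ∧
      (∀ t, X t = X (projIcc 0 T hT t)) ∧
      ∀ ω, IsLinearPath T x₀ F (fun t ↦ brownianPath W t ω) (fun t ↦ X t ω) := by
  obtain ⟨Φ, Ψ, hΦ0, hΦ, hΨ, hinv, hd⟩ := exists_fundamentalMatrix hF hT
  set y : ℝ → Ω → Fin n → ℝ := fun t ω ↦
    Φ t *ᵥ (x₀ + ∫ s in (0 : ℝ)..t, Ψ s *ᵥ (F s *ᵥ brownianPath W s ω)) with hy
  have hyc : ∀ ω, _ := fun ω ↦ variation_of_constants hF hΦ0 hΨ hinv hd x₀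
    (continuous_brownianPath (W := W) ω) (y := fun t ↦ y t ω) fun t ↦ rfl
  set X₁ : ℝ → Ω → Fin n → ℝ := fun t ω ↦ y t ω + brownianPath W t ω with hX₁
  have hX₁c : ∀ ω, ContinuousOn (fun t ↦ X₁ t ω) (Icc 0 T) := fun ω ↦
    (hyc ω).1.add (continuous_brownianPath ω).continuousOn
  have hproj : ∀ t ∈ Icc 0 T, X₁ (projIcc 0 T hT t) = X₁ t := fun t ht ↦ by
    rw [projIcc_of_mem hT ht]
  -- Freezing time outside `[0, T]` makes the paths continuous on the whole line, although `Φ` and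
  -- `Ψ` are controlled only on `[0, T]`.
  refine ⟨fun t ↦ X₁ (projIcc 0 T hT t), fun t ht ↦ ?_, fun ω ↦ ?_, fun t ↦ ?_,
    fun ω ↦ ⟨?_, fun t ht ↦ ?_⟩⟩
  · simp only [hproj t ht]
    have hΨc : Continuous fun s ↦ Ψ (projIcc 0 T hT s) :=
      (continuousOn_iff_continuous_domRestrict.1 hΨ).comp continuous_projIcc
    -- Measurability of the integral is obtained from an integrand that is `ℱ_t`-measurable for
    -- every real `s`; the cut-off `min s t` ensures this without changing the values for `s ≤ t`.
    have key : Measurable[brownianSigma W μ t.toNNReal] fun ω ↦ ∫ s in (0 : ℝ)..t,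
        Ψ (projIcc 0 T hT s) *ᵥ (F s *ᵥ brownianPath W (min s t) ω) := by
      refine measurable_intervalIntegral_of_continuous (m := brownianSigma W μ t.toNNReal)
        (u := fun s ω ↦ Ψ (projIcc 0 T hT s) *ᵥ (F s *ᵥ brownianPath W (min s t) ω))
        (fun ω ↦ ?_) (fun s ↦ ?_) ht.1
      · have := (continuous_brownianPath (W := W) ω).comp (continuous_id.min continuous_const)
          (f := fun s ↦ min s t)
        exact hΨc.matrix_mulVec (hF.matrix_mulVec this)
      · refine measurable_mulVec (m := brownianSigma W μ t.toNNReal) _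
          (measurable_mulVec (m := brownianSigma W μ t.toNNReal) _ ?_)
        exact (hW.measurable_brownianPath (min s t)).mono
          (brownianSigma_mono (Real.toNNReal_mono (min_le_right s t))) le_rfl
    have e : X₁ t = fun ω ↦ Φ t *ᵥ (x₀ + ∫ s in (0 : ℝ)..t,
        Ψ (projIcc 0 T hT s) *ᵥ (F s *ᵥ brownianPath W (min s t) ω)) + brownianPath W t ω := by
      ext1 ω
      simp only [hX₁, hy]
      congr 3
      refine intervalIntegral.integral_congr fun s hs ↦ ?_
      rw [uIcc_of_le ht.1] at hs
      simp only [min_eq_left hs.2, projIcc_of_mem hT ⟨hs.1, hs.2.trans ht.2⟩]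
    rw [e]
    exact measurable_mulVec_const_add_add (m := brownianSigma W μ t.toNNReal) _ _ key
      (hW.measurable_brownianPath t)
  · exact (continuousOn_iff_continuous_domRestrict.1 (hX₁c ω)).comp continuous_projIcc
  · simp
  · exact ((continuousOn_iff_continuous_domRestrict.1 (hX₁c ω)).comp continuous_projIcc).continuousOn
  · change X₁ (projIcc 0 T hT t) ω = _
    rw [hproj t ht]
    change y t ω + _ = _
    rw [(hyc ω).2 t ht]
    congr 2
    refine intervalIntegral.integral_congr fun s hs ↦ ?_
    have hs' := uIcc_subset_Icc_of_mem ht hs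
    simp only
    rw [projIcc_of_mem hT hs']

end existence

end

/-! ### Second moments and nondegeneracy -/

section

variable {n d : ℕ}

lemma abs_dotProduct_le (a b : Fin n → ℝ) : |a ⬝ᵥ b| ≤ n * ‖a‖ * ‖b‖ := by
  calc |a ⬝ᵥ b| ≤ ∑ i, |a i * b i| := Finset.abs_sum_le_sum_abs _ _
    _ ≤ ∑ _i : Fin n, ‖a‖ * ‖b‖ := by
        gcongr with i
        rw [abs_mul]
        exact mul_le_mul (norm_le_pi_norm a i) (norm_le_pi_norm b i) (abs_nonneg _) (norm_nonneg _)
    _ = n * ‖a‖ * ‖b‖ := by simp [mul_assoc]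

/-- A continuous process whose paths solve the linear equation driven by the Brownian paths. -/
structure IsLinearProcess {Ω : Type*} [MeasurableSpace Ω] (T : ℝ) (x₀ : Fin n → ℝ) (F : ℝ → Matrix (Fin n) (Fin n) ℝ)
    (W : ℝ≥0 → Ω → Fin n → ℝ) (X : ℝ → Ω → Fin n → ℝ) : Prop where
  measurable : ∀ t, Measurable (X t)
  continuous : ∀ ω, Continuous fun t ↦ X t ω
  path : ∀ ω, IsLinearPath T x₀ F (fun t ↦ brownianPath W t ω) (fun t ↦ X t ω)

/-- The process dominating the squared norm of the state. -/
def dominator {Ω : Type*} (T : ℝ) (W : ℝ≥0 → Ω → Fin n → ℝ) (t : ℝ) (ω : Ω) : ℝ :=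
  1 + ‖brownianPath W t ω‖ ^ 2 + ∫ s in (0 : ℝ)..T, ‖brownianPath W s ω‖ ^ 2

variable {Ω : Type*} {mΩ : MeasurableSpace Ω} {μ : Measure Ω} {W : ℝ≥0 → Ω → Fin n → ℝ}
  {T : ℝ} {x₀ : Fin n → ℝ} {F : ℝ → Matrix (Fin n) (Fin n) ℝ} {X : ℝ → Ω → Fin n → ℝ}

lemma measurable_process {E : Type*} [NormedAddCommGroup E] [MeasurableSpace E] [BorelSpace E]
    {u : ℝ → Ω → E} (hc : ∀ ω, Continuous fun s ↦ u s ω)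
    (hm : ∀ s, Measurable (u s)) : Measurable fun p : Ω × ℝ ↦ u p.2 p.1 :=
  (measurable_uncurry_of_continuous_of_measurable hc hm).comp measurable_swap

lemma IsStandardBrownian.measurable_brownianPath' [μ.IsComplete] (hW : IsStandardBrownian W μ)
    (t : ℝ) : Measurable (brownianPath W t) :=
  (hW.measurable_brownianPath t).mono (brownianSigma_le hW _) le_rfl

lemma sq_norm_le_sum (x : Fin n → ℝ) : ‖x‖ ^ 2 ≤ ∑ i, x i ^ 2 := by
  have h0 : 0 ≤ ∑ i, x i ^ 2 := by positivity
  have : ‖x‖ ≤ √(∑ i, x i ^ 2) := by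
    refine (pi_norm_le_iff_of_nonneg (Real.sqrt_nonneg _)).2 fun i ↦ ?_
    refine Real.le_sqrt_of_sq_le ?_
    rw [Real.norm_eq_abs, sq_abs]
    exact Finset.single_le_sum (f := fun i ↦ x i ^ 2) (fun i _ ↦ sq_nonneg _) (Finset.mem_univ i)
  calc ‖x‖ ^ 2 ≤ √(∑ i, x i ^ 2) ^ 2 := by gcongr
    _ = _ := Real.sq_sqrt h0

section moments

variable [IsProbabilityMeasure μ]

lemma IsStandardBrownian.integral_sq_apply (hW : IsStandardBrownian W μ) {t : ℝ} (ht : 0 ≤ t)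
    (i : Fin n) : Integrable (fun ω ↦ brownianPath W t ω i ^ 2) μ ∧
      ∫ ω, brownianPath W t ω i ^ 2 ∂μ = t := by
  obtain ⟨h1, h2⟩ := hW.integral_sq_dotProduct_sub le_rfl ht (Pi.single i 1)
  have e : (fun ω ↦ (Pi.single i 1 ⬝ᵥ (brownianPath W t ω - brownianPath W 0 ω)) ^ 2) =ᵐ[μ]
      fun ω ↦ brownianPath W t ω i ^ 2 := by
    filter_upwards [hW.ae_brownianPath_zero] with ω hω
    simp [hω]
  exact ⟨h1.congr e, by rw [← integral_congr_ae e, h2]; simp⟩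

lemma integrable_prod_of_bounded {u : ℝ → Ω → ℝ} (hu0 : ∀ t ω, 0 ≤ u t ω)
    (hm : Measurable fun p : Ω × ℝ ↦ u p.2 p.1) {M : ℝ}
    (hi : ∀ t ∈ Icc 0 T, Integrable (u t) μ) (hM : ∀ t ∈ Icc 0 T, ∫ ω, u t ω ∂μ ≤ M) :
    Integrable (fun p : Ω × ℝ ↦ u p.2 p.1) (μ.prod (volume.restrict (Ioc 0 T))) := by
  rw [integrable_prod_iff' hm.aestronglyMeasurable]
  refine ⟨?_, ?_⟩
  · filter_upwards [ae_restrict_mem measurableSet_Ioc] with t ht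
    exact hi t (Ioc_subset_Icc_self ht)
  · refine Measure.integrableOn_of_bounded (M := M) (by simp) ?_ ?_
    · exact (hm.norm.stronglyMeasurable.comp_measurable
        measurable_swap).integral_prod_right'.aestronglyMeasurable
    · filter_upwards [ae_restrict_mem measurableSet_Ioc] with t ht
      simp only [Real.norm_of_nonneg (hu0 t _)]
      rw [Real.norm_of_nonneg (integral_nonneg fun ω ↦ hu0 t ω)]
      exact hM t (Ioc_subset_Icc_self ht)

variable [μ.IsComplete]

lemma IsStandardBrownian.integral_sq_norm_le (hW : IsStandardBrownian W μ) {t : ℝ} (ht : 0 ≤ t) :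
    Integrable (fun ω ↦ ‖brownianPath W t ω‖ ^ 2) μ ∧
      ∫ ω, ‖brownianPath W t ω‖ ^ 2 ∂μ ≤ n * t := by
  have hs : Integrable (fun ω ↦ ∑ i, brownianPath W t ω i ^ 2) μ :=
    integrable_finsetSum _ fun i _ ↦ (hW.integral_sq_apply ht i).1
  have hi : Integrable (fun ω ↦ ‖brownianPath W t ω‖ ^ 2) μ := by
    refine hs.mono' ((hW.measurable_brownianPath' t).norm.pow_const 2).aestronglyMeasurable
      (ae_of_all _ fun ω ↦ ?_)
    rw [Real.norm_of_nonneg (sq_nonneg _)]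
    exact sq_norm_le_sum _
  refine ⟨hi, (integral_mono hi hs fun ω ↦ sq_norm_le_sum _).trans ?_⟩
  rw [integral_finsetSum _ fun i _ ↦ (hW.integral_sq_apply ht i).1]
  simp [fun i ↦ (hW.integral_sq_apply ht i).2]

lemma IsStandardBrownian.integrable_sq_norm_prod (hW : IsStandardBrownian W μ) :
    Integrable (fun p : Ω × ℝ ↦ ‖brownianPath W p.2 p.1‖ ^ 2)
      (μ.prod (volume.restrict (Ioc 0 T))) := by
  refine integrable_prod_of_bounded (u := fun t ω ↦ ‖brownianPath W t ω‖ ^ 2) (M := n * T)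
    (fun _ _ ↦ sq_nonneg _)
    ((measurable_process continuous_brownianPath hW.measurable_brownianPath').norm.pow_const 2)
    (fun t ht ↦ (hW.integral_sq_norm_le ht.1).1)
    fun t ht ↦ (hW.integral_sq_norm_le ht.1).2.trans ?_
  gcongr
  exact ht.2

lemma IsStandardBrownian.integrable_integral_sq_norm (hW : IsStandardBrownian W μ) (hT : 0 ≤ T) :
    Integrable (fun ω ↦ ∫ s in (0 : ℝ)..T, ‖brownianPath W s ω‖ ^ 2) μ := by
  simp only [intervalIntegral.integral_of_le hT]
  exact hW.integrable_sq_norm_prod.integral_prod_left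

lemma IsStandardBrownian.integrable_dominator_prod (hW : IsStandardBrownian W μ) (hT : 0 ≤ T) :
    Integrable (fun p : Ω × ℝ ↦ dominator T W p.2 p.1) (μ.prod (volume.restrict (Ioc 0 T))) :=
  ((integrable_const 1).add hW.integrable_sq_norm_prod).add
    ((hW.integrable_integral_sq_norm hT).comp_fst _)

lemma IsStandardBrownian.integrable_dominator (hW : IsStandardBrownian W μ) (hT : 0 ≤ T) {t : ℝ}
    (ht : 0 ≤ t) : Integrable (dominator T W t) μ :=
  ((integrable_const 1).add (hW.integral_sq_norm_le ht).1).add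
    (hW.integrable_integral_sq_norm hT)

/-- Uniform second moment bounds for solutions of linear equations. -/
lemma IsLinearProcess.sq_norm (hX : IsLinearProcess T x₀ F W X) (hW : IsStandardBrownian W μ)
    (hT : 0 ≤ T) (hF : Continuous F) :
    ∃ M, 0 ≤ M ∧ (∀ t ∈ Icc 0 T, Integrable (fun ω ↦ ‖X t ω‖ ^ 2) μ ∧
      ∫ ω, ‖X t ω‖ ^ 2 ∂μ ≤ M) ∧
      Integrable (fun p : Ω × ℝ ↦ ‖X p.2 p.1‖ ^ 2) (μ.prod (volume.restrict (Ioc 0 T))) := by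
  obtain ⟨L, hL0, hL⟩ := exists_absSum_le hF T
  set C := growthConst T L x₀
  set j := ∫ ω, (∫ s in (0 : ℝ)..T, ‖brownianPath W s ω‖ ^ 2) ∂μ with hj
  have hC : 0 ≤ C := growthConst_nonneg hT L x₀
  have hj0 : 0 ≤ j := integral_nonneg fun ω ↦
    intervalIntegral.integral_nonneg hT fun _ _ ↦ sq_nonneg _
  have hle : ∀ t ∈ Icc 0 T, ∀ ω, ‖X t ω‖ ^ 2 ≤ C * dominator T W t ω := fun t ht ω ↦
    (hX.path ω).sq_norm_le hF (continuous_brownianPath ω) hL0 hL ht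
  have h1 : ∀ t ∈ Icc 0 T, Integrable (fun ω ↦ ‖X t ω‖ ^ 2) μ ∧
      ∫ ω, ‖X t ω‖ ^ 2 ∂μ ≤ C * (1 + n * T + j) := by
    intro t ht
    have hd := (hW.integrable_dominator hT ht.1).const_mul C
    have hi : Integrable (fun ω ↦ ‖X t ω‖ ^ 2) μ := by
      refine hd.mono' ((hX.measurable t).norm.pow_const 2).aestronglyMeasurable
        (ae_of_all _ fun ω ↦ ?_)
      rw [Real.norm_of_nonneg (sq_nonneg _)]
      exact hle t ht ω
    refine ⟨hi, (integral_mono hi hd (hle t ht)).trans ?_⟩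
    rw [integral_const_mul]
    gcongr
    obtain ⟨hw, hw'⟩ := hW.integral_sq_norm_le ht.1
    unfold dominator
    rw [integral_add (by exact (integrable_const 1).add hw) (hW.integrable_integral_sq_norm hT),
      integral_add (integrable_const 1) hw]
    simp only [integral_const, probReal_univ, one_smul]
    have : (n : ℝ) * t ≤ n * T := by gcongr; exact ht.2
    linarith
  refine ⟨C * (1 + n * T + j), by positivity, h1, ?_⟩
  exact integrable_prod_of_bounded (u := fun t ω ↦ ‖X t ω‖ ^ 2) (fun _ _ ↦ sq_nonneg _)
    ((measurable_process hX.continuous hX.measurable).norm.pow_const 2)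
    (fun t ht ↦ (h1 t ht).1) (fun t ht ↦ (h1 t ht).2)

/-- A solution of a linear equation driven by Brownian motion satisfies no nontrivial linear
relation with differentiable coefficients. -/
lemma IsLinearProcess.eq_zero_of_dotProduct_eq_zero (hX : IsLinearProcess T x₀ F W X)
    (hW : IsStandardBrownian W μ) (hF : Continuous F) {c : ℝ → Fin n → ℝ} {t : ℝ}
    (ht : t ∈ Ioc 0 T) (hc : DifferentiableAt ℝ c t)
    (h : ∀ s ∈ Icc 0 T, ∀ᵐ ω ∂μ, c s ⬝ᵥ X s ω = 0) : c t = 0 := by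
  have hT : 0 ≤ T := ht.1.le.trans ht.2
  have ht' := Ioc_subset_Icc_self ht
  obtain ⟨L, hL0, hL⟩ := exists_absSum_le hF T
  obtain ⟨M, hM0, hM, hMp⟩ := hX.sq_norm hW hT hF
  -- Differentiability is used only through `‖c s - c t‖ ≤ C |s - t|` for `s` near `t`.
  obtain ⟨C, hC⟩ := hc.isBigO_sub.bound
  set D : ℝ := (n * ‖c t‖ * L) ^ 2 with hD
  set K : ℝ := 2 * (n * C) ^ 2 * M + 2 * D * M with hK
  -- The second moment of `c(t) ⬝ᵥ (W_t - W_s)` is `|c(t)|² (t - s)`, and the linear relation bounds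
  -- it by `K (t - s)²`. One factor `t - s` is cancelled before letting `s` increase to `t`.
  have key : ∀ᶠ s in 𝓝[<] t, c t ⬝ᵥ c t ≤ K * (t - s) := by
    filter_upwards [nhdsWithin_le_nhds hC, self_mem_nhdsWithin,
      nhdsWithin_le_nhds (lt_mem_nhds ht.1)] with s hs hst hs0
    have hst : s < t := hst
    have hsI : s ∈ Icc 0 T := ⟨hs0.le, hst.le.trans ht.2⟩
    have hsub : Icc s t ⊆ Icc 0 T := Icc_subset_Icc hs0.le ht.2
    have hpos : 0 < t - s := sub_pos.2 hst
    rw [norm_sub_rev (s : ℝ) t, Real.norm_of_nonneg hpos.le] at hs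
    have hXs : ∀ ω, Continuous fun r ↦ ‖X r ω‖ ^ 2 := fun ω ↦ (hX.continuous ω).norm.pow 2
    have hp : Integrable (fun p : Ω × ℝ ↦ ‖X p.2 p.1‖ ^ 2)
        (μ.prod (volume.restrict (Ioc s t))) :=
      hMp.mono_measure (Measure.prod_mono le_rfl
        (Measure.restrict_mono (Ioc_subset_Ioc hs0.le ht.2) le_rfl))
    have hint : Integrable (fun ω ↦ ∫ r in s..t, ‖X r ω‖ ^ 2) μ := by
      simp only [intervalIntegral.integral_of_le hst.le]
      exact hp.integral_prod_left
    have hintle : ∫ ω, (∫ r in s..t, ‖X r ω‖ ^ 2) ∂μ ≤ M * (t - s) := by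
      simp only [intervalIntegral.integral_of_le hst.le]
      rw [integral_integral_swap hp]
      have : ∫ r in Ioc s t, ∫ ω, ‖X r ω‖ ^ 2 ∂μ ≤ ∫ _ in Ioc s t, M := by
        refine setIntegral_mono_on hp.integral_prod_right (by simp) measurableSet_Ioc
          fun r hr ↦ (hM r (hsub (Ioc_subset_Icc_self hr))).2
      refine this.trans ?_
      simp [hst.le, mul_comm]
    have hb : ∀ᵐ ω ∂μ, (c t ⬝ᵥ (brownianPath W t ω - brownianPath W s ω)) ^ 2 ≤
        2 * (n * C) ^ 2 * (t - s) ^ 2 * ‖X s ω‖ ^ 2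
          + 2 * D * (t - s) * ∫ r in s..t, ‖X r ω‖ ^ 2 := by
      filter_upwards [h s hsI, h t ht'] with ω h1 h2
      have hFX : Continuous fun r ↦ F r *ᵥ X r ω := hF.matrix_mulVec (hX.continuous ω)
      have hcFX : Continuous fun r ↦ c t ⬝ᵥ (F r *ᵥ X r ω) := by
        simp only [dotProduct]
        have := fun i ↦ (continuous_apply i).comp hFX
        fun_prop
      have e1 : brownianPath W t ω - brownianPath W s ω =
          X t ω - X s ω - ∫ r in s..t, F r *ᵥ X r ω := by
        have i1 : X t ω = _ := (hX.path ω).integral_eq t ht'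
        have i2 : X s ω = _ := (hX.path ω).integral_eq s hsI
        rw [i1, i2, ← intervalIntegral.integral_add_adjacent_intervals
          (hFX.intervalIntegrable 0 s) (hFX.intervalIntegrable s t)]
        abel
      have e2 : c t ⬝ᵥ (∫ r in s..t, F r *ᵥ X r ω) = ∫ r in s..t, c t ⬝ᵥ (F r *ᵥ X r ω) := by
        let ℓ : (Fin n → ℝ) →L[ℝ] ℝ := LinearMap.toContinuousLinearMap
          { toFun := fun x ↦ c t ⬝ᵥ x
            map_add' := dotProduct_add _
            map_smul' := fun a x ↦ dotProduct_smul a _ x }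
        exact (ℓ.intervalIntegral_comp_comm (hFX.intervalIntegrable s t)).symm
      -- The relation at time `t` removes `X_t`; the relation at time `s` replaces `-c(t) ⬝ᵥ X_s` by
      -- `(c(s) - c(t)) ⬝ᵥ X_s`, which is of order `t - s`.
      have e3 : c t ⬝ᵥ (brownianPath W t ω - brownianPath W s ω) =
          (c s - c t) ⬝ᵥ X s ω - ∫ r in s..t, c t ⬝ᵥ (F r *ᵥ X r ω) := by
        rw [e1, dotProduct_sub, dotProduct_sub, h2, e2, sub_dotProduct, h1]
      have b1 : ((c s - c t) ⬝ᵥ X s ω) ^ 2 ≤ (n * C) ^ 2 * (t - s) ^ 2 * ‖X s ω‖ ^ 2 := by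
        rw [← mul_pow, ← mul_pow, ← sq_abs]
        gcongr
        refine (abs_dotProduct_le _ _).trans ?_
        rw [mul_assoc (n : ℝ) C]
        gcongr
      have b2 : (∫ r in s..t, c t ⬝ᵥ (F r *ᵥ X r ω)) ^ 2 ≤
          D * (t - s) * ∫ r in s..t, ‖X r ω‖ ^ 2 := by
        refine (sq_intervalIntegral_le hst.le hcFX.continuousOn).trans ?_
        rw [mul_comm D, mul_assoc]
        gcongr
        rw [← intervalIntegral.integral_const_mul]
        refine intervalIntegral.integral_mono_on hst.le
          ((hcFX.pow 2).intervalIntegrable _ _) (((hXs ω).const_mul D).intervalIntegrable _ _)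
          fun r hr ↦ ?_
        rw [hD, ← mul_pow, ← sq_abs]
        gcongr
        refine (abs_dotProduct_le _ _).trans ?_
        rw [mul_assoc _ L]
        gcongr
        refine (norm_mulVec_le _ _).trans ?_
        gcongr
        exact hL r (hsub hr)
      rw [e3]
      -- This is `(p - q)² ≤ 2 p² + 2 q²`, the source of the factors 2 in `K`.
      nlinarith [sq_nonneg ((c s - c t) ⬝ᵥ X s ω + ∫ r in s..t, c t ⬝ᵥ (F r *ᵥ X r ω))]
    obtain ⟨hq, hq'⟩ := hW.integral_sq_dotProduct_sub hs0.le hst.le (c t)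
    have hle := integral_mono_ae hq (((hM s hsI).1.const_mul _).add (hint.const_mul _)) hb
    rw [hq', integral_add' ((hM s hsI).1.const_mul _) (hint.const_mul _), integral_const_mul,
      integral_const_mul] at hle
    have b3 : 2 * (n * C) ^ 2 * (t - s) ^ 2 * ∫ ω, ‖X s ω‖ ^ 2 ∂μ ≤
        2 * (n * C) ^ 2 * (t - s) ^ 2 * M := by
      gcongr
      exact (hM s hsI).2
    have b4 : 2 * D * (t - s) * ∫ ω, (∫ r in s..t, ‖X r ω‖ ^ 2) ∂μ ≤
        2 * D * (t - s) * (M * (t - s)) := by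
      gcongr
    refine le_of_mul_le_mul_right ?_ hpos
    calc (c t ⬝ᵥ c t) * (t - s) ≤ _ := hle.trans (add_le_add b3 b4)
      _ = K * (t - s) * (t - s) := by rw [hK]; ring
  have hlim : Tendsto (fun s ↦ K * (t - s)) (𝓝[<] t) (𝓝 0) := by
    have : Tendsto (fun s ↦ K * (t - s)) (𝓝 t) (𝓝 (K * (t - t))) :=
      Continuous.tendsto (by fun_prop) t
    rw [sub_self, mul_zero] at this
    exact this.mono_left nhdsWithin_le_nhds
  have h0 : c t ⬝ᵥ c t ≤ 0 := ge_of_tendsto hlim key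
  exact dotProduct_self_eq_zero.1 (le_antisymm h0 (by
    simpa using dotProduct_star_self_nonneg (c t)))

end moments

end

/-! ### Quadratic forms, eigenvalues and rank -/

section

variable {n d : ℕ}

section matrix

variable {ι κ : Type*} [Fintype ι] [Fintype κ]

lemma abs_dotProduct_mulVec_le (M : Matrix ι ι ℝ) (v : ι → ℝ) :
    |v ⬝ᵥ (M *ᵥ v)| ≤ absSum M * ‖v‖ ^ 2 := by
  calc |v ⬝ᵥ (M *ᵥ v)| = |∑ i, ∑ j, v i * (M i j * v j)| := by
        simp [dotProduct, Matrix.mulVec, Finset.mul_sum]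
    _ ≤ ∑ i, ∑ j, |v i * (M i j * v j)| :=
        (Finset.abs_sum_le_sum_abs _ _).trans
          (Finset.sum_le_sum fun i _ ↦ Finset.abs_sum_le_sum_abs _ _)
    _ ≤ ∑ i, ∑ j, |M i j| * ‖v‖ ^ 2 := by
        gcongr with i _ j
        rw [abs_mul, abs_mul]
        have h1 : |v i| ≤ ‖v‖ := norm_le_pi_norm v i
        have h2 : |v j| ≤ ‖v‖ := norm_le_pi_norm v j
        calc |v i| * (|M i j| * |v j|) ≤ ‖v‖ * (|M i j| * ‖v‖) := by gcongr
          _ = _ := by ring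
    _ = _ := by simp [absSum, Finset.sum_mul]

lemma dotProduct_self_le (v : ι → ℝ) : v ⬝ᵥ v ≤ Fintype.card ι * ‖v‖ ^ 2 := by
  calc v ⬝ᵥ v = ∑ i, v i ^ 2 := by simp [dotProduct, sq]
    _ ≤ ∑ _i : ι, ‖v‖ ^ 2 := by
        gcongr ∑ i, ?_ with i
        rw [← sq_abs]
        gcongr
        exact norm_le_pi_norm v i
    _ = _ := by simp

/-- A positive definite matrix is uniformly positive on the unit sphere. -/
lemma exists_pos_mul_sq_norm_le [Nonempty ι] {M : Matrix ι ι ℝ} (hM : M.PosDef) :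
    ∃ m > 0, ∀ v : ι → ℝ, m * ‖v‖ ^ 2 ≤ v ⬝ᵥ (M *ᵥ v) := by
  have hc : Continuous fun v : ι → ℝ ↦ v ⬝ᵥ (M *ᵥ v) := by
    simp only [dotProduct, Matrix.mulVec]
    fun_prop
  obtain ⟨u, hu, humin⟩ := (isCompact_sphere (0 : ι → ℝ) 1).exists_isMinOn
    (NormedSpace.sphere_nonempty.2 zero_le_one) hc.continuousOn
  have hu1 : ‖u‖ = 1 := by simpa using hu
  have hu0 : u ≠ 0 := by
    rintro rfl
    simp at hu1
  refine ⟨u ⬝ᵥ (M *ᵥ u), by simpa using hM.dotProduct_mulVec_pos hu0, fun v ↦ ?_⟩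
  rcases eq_or_ne v 0 with rfl | hv
  · simp
  have hv' : 0 < ‖v‖ := norm_pos_iff.2 hv
  have h1 : u ⬝ᵥ (M *ᵥ u) ≤ (‖v‖⁻¹ • v) ⬝ᵥ (M *ᵥ (‖v‖⁻¹ • v)) :=
    humin (by simp [norm_smul, hv'.ne'])
  rw [Matrix.mulVec_smul, dotProduct_smul, smul_dotProduct, smul_eq_mul, smul_eq_mul] at h1
  calc _ ≤ (‖v‖⁻¹ * (‖v‖⁻¹ * v ⬝ᵥ (M *ᵥ v))) * ‖v‖ ^ 2 := by gcongr
    _ = _ := by field_simp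

variable [DecidableEq ι]

lemma hasEigenvalue_toLin'_iff {M : Matrix ι ι ℝ} {r : ℝ} :
    Module.End.HasEigenvalue (Matrix.toLin' M) r ↔ ∃ v, v ≠ 0 ∧ M *ᵥ v = r • v := by
  constructor
  · intro h
    obtain ⟨v, hv⟩ := h.exists_hasEigenvector
    exact ⟨v, hv.2, by simpa using hv.apply_eq_smul⟩
  · rintro ⟨v, hv0, hv⟩
    exact Module.End.hasEigenvalue_of_hasEigenvector
      (Module.End.hasEigenvector_iff.2 ⟨Module.End.mem_eigenspace_iff.2 (by simpa using hv), hv0⟩)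

/-- The norm on `ι → ℝ` is the sup norm, so `v ⬝ᵥ v ≤ card ι * ‖v‖²`; hence the division by the
cardinality. -/
lemma le_of_hasEigenvalue [Nonempty ι] {M : Matrix ι ι ℝ} {m : ℝ} (hm : 0 ≤ m)
    (h : ∀ v : ι → ℝ, m * ‖v‖ ^ 2 ≤ v ⬝ᵥ (M *ᵥ v)) {r : ℝ}
    (hr : Module.End.HasEigenvalue (Matrix.toLin' M) r) : m / Fintype.card ι ≤ r := by
  obtain ⟨v, hv0, hv⟩ := hasEigenvalue_toLin'_iff.1 hr
  have h1 := h v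
  rw [hv, dotProduct_smul, smul_eq_mul] at h1
  have hpos : 0 < v ⬝ᵥ v := lt_of_le_of_ne (by simpa using dotProduct_star_self_nonneg v)
    fun h0 ↦ hv0 (dotProduct_self_eq_zero.1 h0.symm)
  have hcard : (0 : ℝ) < Fintype.card ι := by exact_mod_cast Fintype.card_pos
  refine le_of_mul_le_mul_right ?_ hpos
  calc m / Fintype.card ι * (v ⬝ᵥ v) ≤ m / Fintype.card ι * (Fintype.card ι * ‖v‖ ^ 2) := by
        gcongr
        exact dotProduct_self_le v
    _ = m * ‖v‖ ^ 2 := by field_simp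
    _ ≤ _ := h1

/-- Symmetry provides an eigenvalue: the infimum must be over a nonempty set, since `sInf ∅ = 0`
would be a spurious value. -/
lemma le_minEigenvalue [Nonempty ι] {M : Matrix ι ι ℝ} (hM : M.IsHermitian) {m : ℝ} (hm : 0 ≤ m)
    (h : ∀ v : ι → ℝ, m * ‖v‖ ^ 2 ≤ v ⬝ᵥ (M *ᵥ v)) : m / Fintype.card ι ≤ minEigenvalue M := by
  refine le_csInf ?_ fun r hr ↦ le_of_hasEigenvalue hm h hr
  let i : ι := Classical.arbitrary ι
  refine ⟨hM.eigenvalues i, hasEigenvalue_toLin'_iff.2 ⟨_, fun h0 ↦ ?_, hM.mulVec_eigenvectorBasis i⟩⟩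
  exact hM.eigenvectorBasis.toBasis.ne_zero i (by ext j; simpa using congrFun h0 j)

/-- Zero is an eigenvalue, and nonnegativity of the form supplies the lower bound without which the
infimum is not controlled by its elements. -/
lemma minEigenvalue_nonpos [Nonempty ι] {M : Matrix ι ι ℝ} (h : ∀ v : ι → ℝ, 0 ≤ v ⬝ᵥ (M *ᵥ v))
    {v : ι → ℝ} (hv : v ≠ 0) (hMv : M *ᵥ v = 0) : minEigenvalue M ≤ 0 := by
  refine csInf_le ⟨0, fun r hr ↦ ?_⟩ (hasEigenvalue_toLin'_iff.2 ⟨v, hv, by simpa using hMv⟩)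
  simpa using le_of_hasEigenvalue le_rfl (by simpa using h) hr

omit [DecidableEq ι] in
lemma exists_euclNorm_sub_le_imp {U : Set (Matrix ι κ ℝ)} {M₀ : Matrix ι κ ℝ} (hU : U ∈ 𝓝 M₀) :
    ∃ ε > 0, ∀ M, euclNorm (M - M₀) ≤ ε → M ∈ U := by
  -- The topology on matrices is the product one, so sup-metric balls form a basis; `euclNorm`
  -- dominates the sup distance.
  have hU' : U ∈ @nhds (ι → κ → ℝ) _ M₀ := hU
  obtain ⟨ε, hε, hball⟩ := Metric.nhds_basis_closedBall.mem_iff.1 hU'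
  refine ⟨ε, hε, fun M hM ↦ hball ?_⟩
  refine (dist_pi_le_iff hε.le).2 fun i ↦ (dist_pi_le_iff hε.le).2 fun j ↦ ?_
  refine le_trans ?_ hM
  rw [Real.dist_eq, ← Matrix.sub_apply]
  refine Real.le_sqrt_of_sq_le ?_
  rw [sq_abs]
  exact (Finset.single_le_sum (f := fun j ↦ (M - M₀) i j ^ 2) (fun j _ ↦ sq_nonneg _)
    (Finset.mem_univ j)).trans (Finset.single_le_sum (f := fun i ↦ ∑ j, (M - M₀) i j ^ 2)
      (fun i _ ↦ Finset.sum_nonneg fun j _ ↦ sq_nonneg _) (Finset.mem_univ i))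

lemma rank_eq_iff (B : Matrix (Fin n) (Fin d) ℝ) :
    B.rank = d ↔ ∀ x, B *ᵥ x = 0 → x = 0 := by
  have h := LinearMap.finrank_range_add_finrank_ker B.mulVecLin
  rw [Module.finrank_fin_fun] at h
  have e : B.rank = Module.finrank ℝ (LinearMap.range B.mulVecLin) := rfl
  have h2 : B.rank = d ↔ Module.finrank ℝ (LinearMap.ker B.mulVecLin) = 0 := by omega
  rw [h2, Submodule.finrank_eq_zero, LinearMap.ker_eq_bot']
  rfl

end matrix

/-- The closed-loop drift matrix under the feedback gain of parameter `θ`. -/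
def closedLoop (Astar : Matrix (Fin n) (Fin n) ℝ) (Bstar : Matrix (Fin n) (Fin d) ℝ) (T : ℝ)
    (Q : Matrix (Fin n) (Fin n) ℝ) (R : Matrix (Fin d) (Fin d) ℝ)
    (θ : Matrix (Fin n ⊕ Fin d) (Fin n) ℝ) (t : ℝ) : Matrix (Fin n) (Fin n) ℝ :=
  Astar + Bstar * hamGain T Q R θ t

/-! ### The state process as a pathwise linear equation -/

section state

variable {Ω : Type*} {mΩ : MeasurableSpace Ω} {μ : Measure Ω} {W : ℝ≥0 → Ω → Fin n → ℝ}
  {T : ℝ} {x₀ : Fin n → ℝ} {Astar : Matrix (Fin n) (Fin n) ℝ} {Bstar : Matrix (Fin n) (Fin d) ℝ}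
  {Q : Matrix (Fin n) (Fin n) ℝ} {R : Matrix (Fin d) (Fin d) ℝ}
  {X : ℝ → Ω → Fin n → ℝ}

lemma continuous_closedLoop (hQ : Q.PosDef) (hR : R.PosDef) :
    Continuous fun p : Matrix (Fin n ⊕ Fin d) (Fin n) ℝ × ℝ ↦
      closedLoop Astar Bstar T Q R p.1 p.2 :=
  continuous_const.add (continuous_const.matrix_mul (continuous_hamGain hQ hR))

lemma continuous_closedLoop_right (hQ : Q.PosDef) (hR : R.PosDef)
    (θ : Matrix (Fin n ⊕ Fin d) (Fin n) ℝ) : Continuous (closedLoop Astar Bstar T Q R θ) :=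
  Continuous.comp (g := fun p : Matrix (Fin n ⊕ Fin d) (Fin n) ℝ × ℝ ↦
    closedLoop Astar Bstar T Q R p.1 p.2) (f := fun t : ℝ ↦ (θ, t)) (continuous_closedLoop hQ hR)
    (continuous_const.prodMk continuous_id)

lemma continuous_hamGain_right (hQ : Q.PosDef) (hR : R.PosDef)
    (θ : Matrix (Fin n ⊕ Fin d) (Fin n) ℝ) : Continuous (hamGain T Q R θ) :=
  Continuous.comp (g := fun p : Matrix (Fin n ⊕ Fin d) (Fin n) ℝ × ℝ ↦ hamGain T Q R p.1 p.2)
    (f := fun t : ℝ ↦ (θ, t)) (continuous_hamGain hQ hR)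
    (continuous_const.prodMk continuous_id)

lemma integral_drift_eq (hQ : Q.PosDef) (hR : R.PosDef) (θ : Matrix (Fin n ⊕ Fin d) (Fin n) ℝ)
    (x : ℝ → Fin n → ℝ) {t : ℝ} (ht : t ∈ Icc 0 T) :
    ∫ s in (0 : ℝ)..t, (Astar *ᵥ x s + Bstar *ᵥ policy T Q R θ s (x s)) =
      ∫ s in (0 : ℝ)..t, closedLoop Astar Bstar T Q R θ s *ᵥ x s := by
  refine intervalIntegral.integral_congr fun s hs ↦ ?_
  simp only [policy, gain_eq_hamGain hQ hR θ (uIcc_subset_Icc_of_mem ht hs), closedLoop,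
    Matrix.mulVec_mulVec, Matrix.add_mulVec]

/-- This reduces uniqueness up to indistinguishability to uniqueness for deterministic linear
equations, one path at a time. -/
lemma IsStateProcess.ae_isLinearPath (hW : IsStandardBrownian W μ) (hQ : Q.PosDef)
    (hR : R.PosDef) {θ : Matrix (Fin n ⊕ Fin d) (Fin n) ℝ}
    (hX : IsStateProcess T x₀ Astar Bstar W μ (policy T Q R θ) X) :
    ∀ᵐ ω ∂μ, IsLinearPath T x₀ (closedLoop Astar Bstar T Q R θ) (fun t ↦ brownianPath W t ω)
      (fun t ↦ X t ω) := by
  filter_upwards [hX.integral_eq, hW.ae_brownianPath_eq] with ω h1 h2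
  refine ⟨hX.continuous ω, fun t ht ↦ ?_⟩
  rw [h1 t ht, h2 t, integral_drift_eq hQ hR θ (fun s ↦ X s ω) ht]

/-- The chosen `state` solves its equation only almost surely and is arbitrary outside `[0, T]`. The
version built here solves it for every `ω` with globally continuous paths, and carries all later
computations. -/
lemma exists_isLinearProcess [μ.IsComplete] (hW : IsStandardBrownian W μ) (hT : 0 ≤ T)
    (hQ : Q.PosDef) (hR : R.PosDef) (x₀ : Fin n → ℝ) (θ : Matrix (Fin n ⊕ Fin d) (Fin n) ℝ) :
    ∃ X, IsLinearProcess T x₀ (closedLoop Astar Bstar T Q R θ) W X ∧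
      IsStateProcess T x₀ Astar Bstar W μ (policy T Q R θ) X := by
  obtain ⟨X, hm, hc, hp, hX⟩ := hW.exists_linearProcess hT x₀
    (continuous_closedLoop_right (Astar := Astar) (Bstar := Bstar) (T := T) hQ hR θ)
  refine ⟨X, ⟨fun t ↦ ?_, hc, hX⟩, hm, fun ω ↦ (hc ω).continuousOn, ?_⟩
  · rw [hp t]
    exact (hm _ (projIcc 0 T hT t).2).mono (brownianSigma_le hW _) le_rfl
  · filter_upwards [hW.ae_brownianPath_eq] with ω hω t ht
    rw [(hX ω).integral_eq t ht, ← hω t, integral_drift_eq hQ hR θ (fun s ↦ X s ω) ht]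

lemma isStateProcess_state [μ.IsComplete] (hW : IsStandardBrownian W μ) (hT : 0 ≤ T)
    (hQ : Q.PosDef) (hR : R.PosDef) (x₀ : Fin n → ℝ) (θ : Matrix (Fin n ⊕ Fin d) (Fin n) ℝ) :
    IsStateProcess T x₀ Astar Bstar W μ (policy T Q R θ)
      (state T x₀ Astar Bstar W μ (policy T Q R θ)) := by
  have h : ∃ X, IsStateProcess T x₀ Astar Bstar W μ (policy T Q R θ) X :=
    (exists_isLinearProcess hW hT hQ hR x₀ θ).imp fun _ h ↦ h.2
  rw [state, dif_pos h]
  exact h.choose_spec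

lemma IsStateProcess.ae_eq (hW : IsStandardBrownian W μ) (hQ : Q.PosDef) (hR : R.PosDef)
    {θ : Matrix (Fin n ⊕ Fin d) (Fin n) ℝ} {X' : ℝ → Ω → Fin n → ℝ}
    (hX : IsStateProcess T x₀ Astar Bstar W μ (policy T Q R θ) X)
    (hX' : IsStateProcess T x₀ Astar Bstar W μ (policy T Q R θ) X') :
    ∀ᵐ ω ∂μ, ∀ t ∈ Icc 0 T, X t ω = X' t ω := by
  filter_upwards [hX.ae_isLinearPath hW hQ hR, hX'.ae_isLinearPath hW hQ hR] with ω h1 h2 t ht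
  exact h1.eqOn (continuous_closedLoop_right hQ hR θ) h2 ht

end state

end

/-! ### The expected Gram matrix as a quadratic form -/

section

variable {n d : ℕ}

/-- The joint state and control process associated with a state process `X`. -/
def stateInput {Ω : Type*} (T : ℝ) (Q : Matrix (Fin n) (Fin n) ℝ) (R : Matrix (Fin d) (Fin d) ℝ)
    (θ : Matrix (Fin n ⊕ Fin d) (Fin n) ℝ) (X : ℝ → Ω → Fin n → ℝ) (t : ℝ) (ω : Ω) :
    Fin n ⊕ Fin d → ℝ :=
  Sum.elim (X t ω) (hamGain T Q R θ t *ᵥ X t ω)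

/-- The time-dependent coefficient of the state in the linear form `v ⬝ᵥ stateInput`. -/
def stateCoeff (T : ℝ) (Q : Matrix (Fin n) (Fin n) ℝ) (R : Matrix (Fin d) (Fin d) ℝ)
    (θ : Matrix (Fin n ⊕ Fin d) (Fin n) ℝ) (v : Fin n ⊕ Fin d → ℝ) (t : ℝ) : Fin n → ℝ :=
  v ∘ Sum.inl + (hamGain T Q R θ t)ᵀ *ᵥ (v ∘ Sum.inr)

variable {Ω : Type*} {mΩ : MeasurableSpace Ω} {μ : Measure Ω} {W : ℝ≥0 → Ω → Fin n → ℝ}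
  {T : ℝ} {x₀ : Fin n → ℝ} {Astar : Matrix (Fin n) (Fin n) ℝ} {Bstar : Matrix (Fin n) (Fin d) ℝ}
  {Q : Matrix (Fin n) (Fin n) ℝ} {R : Matrix (Fin d) (Fin d) ℝ}
  {θ : Matrix (Fin n ⊕ Fin d) (Fin n) ℝ} {X : ℝ → Ω → Fin n → ℝ}

omit mΩ in
lemma dotProduct_stateInput (v : Fin n ⊕ Fin d → ℝ) (t : ℝ) (ω : Ω) :
    v ⬝ᵥ stateInput T Q R θ X t ω = stateCoeff T Q R θ v t ⬝ᵥ X t ω := by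
  rw [stateInput, stateCoeff, add_dotProduct, Matrix.mulVec_transpose, ← Matrix.dotProduct_mulVec]
  simp [dotProduct, Fintype.sum_sum_type]

omit mΩ in
lemma norm_stateInput_le {k : ℝ} {t : ℝ} (hk : absSum (hamGain T Q R θ t) ≤ k) (hk0 : 0 ≤ k)
    (ω : Ω) : ‖stateInput T Q R θ X t ω‖ ≤ (1 + k) * ‖X t ω‖ := by
  refine (pi_norm_le_iff_of_nonneg (by positivity)).2 fun i ↦ ?_
  rcases i with i | i
  · refine (norm_le_pi_norm (X t ω) i).trans ?_
    nlinarith [norm_nonneg (X t ω)]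
  · refine (norm_le_pi_norm (hamGain T Q R θ t *ᵥ X t ω) i).trans ((norm_mulVec_le _ _).trans ?_)
    gcongr
    linarith

omit mΩ in
lemma abs_stateInput_mul_le {k : ℝ} {t : ℝ} (hk : absSum (hamGain T Q R θ t) ≤ k) (hk0 : 0 ≤ k)
    (ω : Ω) (i j : Fin n ⊕ Fin d) :
    |stateInput T Q R θ X t ω i * stateInput T Q R θ X t ω j| ≤
      (1 + k) ^ 2 * ‖X t ω‖ ^ 2 := by
  have h := norm_stateInput_le (X := X) hk hk0 ω
  have hi : |stateInput T Q R θ X t ω i| ≤ _ := (norm_le_pi_norm _ i).trans h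
  have hj : |stateInput T Q R θ X t ω j| ≤ _ := (norm_le_pi_norm _ j).trans h
  rw [abs_mul, ← mul_pow, sq]
  gcongr

omit mΩ in
lemma continuous_stateInput (hQ : Q.PosDef) (hR : R.PosDef)
    (hX : ∀ ω, Continuous fun t ↦ X t ω) (ω : Ω) :
    Continuous fun t ↦ stateInput T Q R θ X t ω := by
  refine continuous_pi fun i ↦ ?_
  rcases i with i | i
  · exact (continuous_apply i).comp (hX ω)
  · exact (continuous_apply i).comp ((continuous_hamGain_right hQ hR θ).matrix_mulVec (hX ω))

lemma measurable_stateInput (hX : ∀ t, Measurable (X t)) (t : ℝ) :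
    Measurable (stateInput T Q R θ X t) := by
  refine measurable_pi_iff.2 fun i ↦ ?_
  rcases i with i | i
  · exact (measurable_pi_apply i).comp (hX t)
  · exact (measurable_pi_apply i).comp (measurable_mulVec _ (hX t))

lemma IsLinearProcess.measurable_joint
    (hX : IsLinearProcess T x₀ (closedLoop Astar Bstar T Q R θ) W X)
    (hQ : Q.PosDef) (hR : R.PosDef) :
    Measurable fun p : Ω × ℝ ↦ stateInput T Q R θ X p.2 p.1 := by
  have h := fun i ↦ measurable_process (u := fun t ω ↦ stateInput T Q R θ X t ω i)
    (fun ω ↦ (continuous_apply i).comp (continuous_stateInput hQ hR hX.continuous ω))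
    (fun t ↦ (measurable_pi_apply i).comp (measurable_stateInput hX.measurable t))
  exact measurable_pi_iff.2 h

section expectation

lemma gram_ae_eq (hT : 0 ≤ T) (hQ : Q.PosDef) (hR : R.PosDef)
    (hXs : ∀ᵐ ω ∂μ, ∀ t ∈ Icc 0 T, state T x₀ Astar Bstar W μ (policy T Q R θ) t ω = X t ω)
    (i j : Fin n ⊕ Fin d) :
    ∀ᵐ ω ∂μ, gram T x₀ Astar Bstar W μ (policy T Q R θ) ω i j =
      ∫ t in Ioc 0 T, stateInput T Q R θ X t ω i * stateInput T Q R θ X t ω j := by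
  filter_upwards [hXs] with ω hω
  rw [gram, Matrix.of_apply, ← intervalIntegral.integral_of_le hT]
  refine intervalIntegral.integral_congr fun t ht ↦ ?_
  rw [uIcc_of_le hT] at ht
  have : stateControl T x₀ Astar Bstar W μ (policy T Q R θ) t ω = stateInput T Q R θ X t ω := by
    rw [stateControl, stateInput, hω t ht, policy, gain_eq_hamGain hQ hR θ ht]
  simp only [this]

variable [IsProbabilityMeasure μ] [μ.IsComplete]

lemma IsLinearProcess.integrable_joint_mul
    (hX : IsLinearProcess T x₀ (closedLoop Astar Bstar T Q R θ) W X)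
    (hW : IsStandardBrownian W μ) (hT : 0 ≤ T) (hQ : Q.PosDef) (hR : R.PosDef)
    (i j : Fin n ⊕ Fin d) :
    Integrable (fun p : Ω × ℝ ↦ stateInput T Q R θ X p.2 p.1 i * stateInput T Q R θ X p.2 p.1 j)
      (μ.prod (volume.restrict (Ioc 0 T))) := by
  obtain ⟨k, hk0, hk⟩ := exists_absSum_le (continuous_hamGain_right (T := T) hQ hR θ) T
  obtain ⟨M, -, -, hi⟩ := hX.sq_norm hW hT (continuous_closedLoop_right hQ hR θ)
  have hm := measurable_pi_iff.1 (hX.measurable_joint hQ hR)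
  refine (hi.const_mul ((1 + k) ^ 2)).mono' ((hm i).mul (hm j)).aestronglyMeasurable ?_
  have hae : ∀ᵐ p : Ω × ℝ ∂(μ.prod (volume.restrict (Ioc 0 T))), p.2 ∈ Ioc 0 T :=
    Measure.quasiMeasurePreserving_snd.ae (ae_restrict_mem measurableSet_Ioc)
  filter_upwards [hae] with p hp
  exact abs_stateInput_mul_le (hk _ (Ioc_subset_Icc_self hp)) hk0 _ i j

lemma IsLinearProcess.integrable_gram
    (hX : IsLinearProcess T x₀ (closedLoop Astar Bstar T Q R θ) W X)
    (hW : IsStandardBrownian W μ) (hT : 0 ≤ T) (hQ : Q.PosDef) (hR : R.PosDef)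
    (hXs : ∀ᵐ ω ∂μ, ∀ t ∈ Icc 0 T, state T x₀ Astar Bstar W μ (policy T Q R θ) t ω = X t ω)
    (i j : Fin n ⊕ Fin d) :
    Integrable (fun ω ↦ gram T x₀ Astar Bstar W μ (policy T Q R θ) ω i j) μ :=
  (hX.integrable_joint_mul hW hT hQ hR i j).integral_prod_left.congr
    ((gram_ae_eq hT hQ hR hXs i j).mono fun _ h ↦ h.symm)

lemma IsLinearProcess.expectedGram_apply
    (hX : IsLinearProcess T x₀ (closedLoop Astar Bstar T Q R θ) W X)
    (hW : IsStandardBrownian W μ) (hT : 0 ≤ T) (hQ : Q.PosDef) (hR : R.PosDef)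
    (hXs : ∀ᵐ ω ∂μ, ∀ t ∈ Icc 0 T, state T x₀ Astar Bstar W μ (policy T Q R θ) t ω = X t ω)
    (i j : Fin n ⊕ Fin d) :
    expectedGram T x₀ Astar Bstar W μ (policy T Q R θ) i j =
      ∫ p : Ω × ℝ, stateInput T Q R θ X p.2 p.1 i * stateInput T Q R θ X p.2 p.1 j
        ∂(μ.prod (volume.restrict (Ioc 0 T))) := by
  rw [expectedGram, Matrix.of_apply, integral_congr_ae (gram_ae_eq hT hQ hR hXs i j),
    integral_prod _ (hX.integrable_joint_mul hW hT hQ hR i j)]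

lemma IsLinearProcess.expectedGram_mulVec
    (hX : IsLinearProcess T x₀ (closedLoop Astar Bstar T Q R θ) W X)
    (hW : IsStandardBrownian W μ) (hT : 0 ≤ T) (hQ : Q.PosDef) (hR : R.PosDef)
    (hXs : ∀ᵐ ω ∂μ, ∀ t ∈ Icc 0 T, state T x₀ Astar Bstar W μ (policy T Q R θ) t ω = X t ω)
    (v : Fin n ⊕ Fin d → ℝ) (i : Fin n ⊕ Fin d) :
    Integrable (fun p : Ω × ℝ ↦
      stateInput T Q R θ X p.2 p.1 i * (v ⬝ᵥ stateInput T Q R θ X p.2 p.1))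
        (μ.prod (volume.restrict (Ioc 0 T))) ∧
    (expectedGram T x₀ Astar Bstar W μ (policy T Q R θ) *ᵥ v) i =
      ∫ p : Ω × ℝ, stateInput T Q R θ X p.2 p.1 i * (v ⬝ᵥ stateInput T Q R θ X p.2 p.1)
        ∂(μ.prod (volume.restrict (Ioc 0 T))) := by
  have e : (fun p : Ω × ℝ ↦
      stateInput T Q R θ X p.2 p.1 i * (v ⬝ᵥ stateInput T Q R θ X p.2 p.1)) = fun p ↦
      ∑ j, stateInput T Q R θ X p.2 p.1 i * stateInput T Q R θ X p.2 p.1 j * v j := by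
    ext p
    simp only [dotProduct, Finset.mul_sum]
    exact Finset.sum_congr rfl fun j _ ↦ by ring
  have hi := fun j ↦ (hX.integrable_joint_mul hW hT hQ hR i j).mul_const (v j)
  rw [e]
  refine ⟨integrable_finsetSum _ fun j _ ↦ hi j, ?_⟩
  rw [integral_finsetSum _ fun j _ ↦ hi j]
  simp only [Matrix.mulVec, dotProduct, hX.expectedGram_apply hW hT hQ hR hXs, integral_mul_const]

lemma IsLinearProcess.dotProduct_expectedGram
    (hX : IsLinearProcess T x₀ (closedLoop Astar Bstar T Q R θ) W X)
    (hW : IsStandardBrownian W μ) (hT : 0 ≤ T) (hQ : Q.PosDef) (hR : R.PosDef)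
    (hXs : ∀ᵐ ω ∂μ, ∀ t ∈ Icc 0 T, state T x₀ Astar Bstar W μ (policy T Q R θ) t ω = X t ω)
    (v : Fin n ⊕ Fin d → ℝ) :
    Integrable (fun p : Ω × ℝ ↦ (v ⬝ᵥ stateInput T Q R θ X p.2 p.1) ^ 2)
        (μ.prod (volume.restrict (Ioc 0 T))) ∧
    v ⬝ᵥ (expectedGram T x₀ Astar Bstar W μ (policy T Q R θ) *ᵥ v) =
      ∫ p : Ω × ℝ, (v ⬝ᵥ stateInput T Q R θ X p.2 p.1) ^ 2
        ∂(μ.prod (volume.restrict (Ioc 0 T))) := by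
  have e : (fun p : Ω × ℝ ↦ (v ⬝ᵥ stateInput T Q R θ X p.2 p.1) ^ 2) = fun p ↦
      ∑ i, v i * (stateInput T Q R θ X p.2 p.1 i * (v ⬝ᵥ stateInput T Q R θ X p.2 p.1)) := by
    ext p
    simp only [← mul_assoc, ← Finset.sum_mul]
    rw [sq]
    rfl
  have h := hX.expectedGram_mulVec hW hT hQ hR hXs v
  have hi := fun i ↦ (h i).1.const_mul (v i)
  rw [e]
  refine ⟨integrable_finsetSum _ fun i _ ↦ hi i, ?_⟩
  rw [integral_finsetSum _ fun i _ ↦ hi i]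
  simp only [integral_const_mul, ← (h _).2]
  rfl

omit [IsProbabilityMeasure μ] [μ.IsComplete] in
lemma isHermitian_expectedGram (ψ : ℝ → (Fin n → ℝ) → Fin d → ℝ) :
    (expectedGram T x₀ Astar Bstar W μ ψ).IsHermitian := by
  ext i j
  simp [expectedGram, gram, mul_comm]

/-- A null vector of the expected Gram matrix gives a vanishing coefficient process. -/
lemma IsLinearProcess.stateCoeff_eq_zero
    (hX : IsLinearProcess T x₀ (closedLoop Astar Bstar T Q R θ) W X)
    (hW : IsStandardBrownian W μ) (hT : 0 < T) (hQ : Q.PosDef) (hR : R.PosDef)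
    (hXs : ∀ᵐ ω ∂μ, ∀ t ∈ Icc 0 T, state T x₀ Astar Bstar W μ (policy T Q R θ) t ω = X t ω)
    {v : Fin n ⊕ Fin d → ℝ}
    (hv : v ⬝ᵥ (expectedGram T x₀ Astar Bstar W μ (policy T Q R θ) *ᵥ v) = 0) :
    ∀ t ∈ Ioc 0 T, stateCoeff T Q R θ v t = 0 := by
  obtain ⟨hi, he⟩ := hX.dotProduct_expectedGram hW hT.le hQ hR hXs v
  rw [he, integral_eq_zero_iff_of_nonneg (fun _ ↦ sq_nonneg _) hi] at hv
  -- A vanishing integral of a square gives the relation for almost every `ω` and almost every time;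
  -- path continuity extends it to every time in `[0, T]`.
  have hae := Measure.ae_ae_of_ae_prod hv
  have hall : ∀ᵐ ω ∂μ, ∀ t ∈ Icc 0 T, v ⬝ᵥ stateInput T Q R θ X t ω = 0 := by
    filter_upwards [hae] with ω hω
    have hcont : Continuous fun t ↦ v ⬝ᵥ stateInput T Q R θ X t ω := by
      have := fun i ↦ (continuous_apply i).comp
        (continuous_stateInput (T := T) (θ := θ) hQ hR hX.continuous ω)
      simp only [dotProduct]
      fun_prop
    refine Measure.eqOn_Icc_of_ae_eq volume hT.ne (g := fun _ ↦ (0 : ℝ)) ?_ hcont.continuousOn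
      continuousOn_const
    rw [Measure.restrict_congr_set Ioc_ae_eq_Icc.symm]
    filter_upwards [hω] with t ht
    simpa using ht
  intro t ht
  obtain ⟨K', hK', -⟩ := hasDerivAt_hamGain (T := T) hQ hR θ t
  refine hX.eq_zero_of_dotProduct_eq_zero hW (continuous_closedLoop_right hQ hR θ) ht ?_ ?_
  · refine differentiableAt_pi.2 fun i ↦ ?_
    have := fun j ↦ (hK' j i).differentiableAt
    simp only [stateCoeff, Pi.add_apply, Matrix.mulVec, dotProduct, Matrix.transpose_apply]
    fun_prop
  · intro s hs
    filter_upwards [hall] with ω hω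
    rw [← dotProduct_stateInput]
    exact hω s hs

/-- If `B` has full column rank, then the expected Gram matrix is positive definite. -/
lemma IsLinearProcess.posDef_expectedGram
    (hX : IsLinearProcess T x₀ (closedLoop Astar Bstar T Q R θ) W X)
    (hW : IsStandardBrownian W μ) (hT : 0 < T) (hQ : Q.PosDef) (hR : R.PosDef)
    (hXs : ∀ᵐ ω ∂μ, ∀ t ∈ Icc 0 T, state T x₀ Astar Bstar W μ (policy T Q R θ) t ω = X t ω)
    (hB : ∀ x, paramB θ *ᵥ x = 0 → x = 0) :
    (expectedGram T x₀ Astar Bstar W μ (policy T Q R θ)).PosDef := by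
  refine Matrix.PosDef.of_dotProduct_mulVec_pos (isHermitian_expectedGram _) fun v hv0 ↦ ?_
  rw [star_trivial]
  have hnn : 0 ≤ v ⬝ᵥ (expectedGram T x₀ Astar Bstar W μ (policy T Q R θ) *ᵥ v) := by
    rw [(hX.dotProduct_expectedGram hW hT.le hQ hR hXs v).2]
    exact integral_nonneg fun _ ↦ sq_nonneg _
  refine lt_of_le_of_ne hnn fun h0 ↦ hv0 ?_
  have hc := hX.stateCoeff_eq_zero hW hT hQ hR hXs h0.symm
  have hTm : T ∈ Ioc 0 T := right_mem_Ioc.2 hT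
  -- The gain vanishes at `T`, so there the coefficient is the state block of `v` alone.
  have ha : v ∘ Sum.inl = 0 := by
    have := hc T hTm
    simpa [stateCoeff, hamGain_terminal] using this
  obtain ⟨K', hK', hK'T⟩ := hasDerivAt_hamGain (T := T) hQ hR θ T
  have hd : HasDerivAt (stateCoeff T Q R θ v) (K'ᵀ *ᵥ (v ∘ Sum.inr)) T := by
    have h1 := hasDerivWithinAt_mulVec (s := univ) (M := fun t ↦ (hamGain T Q R θ t)ᵀ)
      (M' := fun _ ↦ K'ᵀ) (v := fun _ ↦ v ∘ Sum.inr) (v' := fun _ ↦ 0)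
      (fun i j ↦ (hK' j i).hasDerivWithinAt) (hasDerivWithinAt_const T univ _)
    rw [hasDerivWithinAt_univ, Matrix.mulVec_zero, add_zero] at h1
    exact h1.const_add _
  -- The coefficient vanishes on `(0, T]`, so its left derivative at `T` is zero. Equating it with
  -- `K'ᵀ` applied to the control block `b` gives `Q B R⁻¹ b = 0`.
  have hd0 : HasDerivWithinAt (stateCoeff T Q R θ v) 0 (Ioc 0 T) T :=
    (hasDerivWithinAt_const T (Ioc 0 T) (0 : Fin n → ℝ)).congr hc (hc T hTm)
  have hz : K'ᵀ *ᵥ (v ∘ Sum.inr) = 0 :=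
    (uniqueDiffOn_Ioc 0 T T hTm).eq_deriv _ hd.hasDerivWithinAt hd0
  have hQt : Qᵀ = Q := by simpa using hQ.isHermitian.eq
  have hRt : R⁻¹ᵀ = R⁻¹ := by simpa using hR.inv.isHermitian.eq
  rw [hK'T rfl, Matrix.transpose_mul, Matrix.transpose_mul, Matrix.transpose_transpose, hQt, hRt,
    ← Matrix.mulVec_mulVec, ← Matrix.mulVec_mulVec] at hz
  have hQu : IsUnit Q := hQ.isUnit
  have hRu : IsUnit R⁻¹ := hR.inv.isUnit
  have h1 := hB _ (Matrix.mulVec_injective_of_isUnit hQu (hz.trans (Matrix.mulVec_zero Q).symm))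
  have hb : v ∘ Sum.inr = 0 :=
    Matrix.mulVec_injective_of_isUnit hRu (h1.trans (Matrix.mulVec_zero R⁻¹).symm)
  ext i
  rcases i with i | i
  · exact congrFun ha i
  · exact congrFun hb i

/-- If `B` does not have full column rank, then the expected Gram matrix is singular. -/
lemma IsLinearProcess.exists_expectedGram_mulVec_eq_zero
    (hX : IsLinearProcess T x₀ (closedLoop Astar Bstar T Q R θ) W X)
    (hW : IsStandardBrownian W μ) (hT : 0 ≤ T) (hQ : Q.PosDef) (hR : R.PosDef)
    (hXs : ∀ᵐ ω ∂μ, ∀ t ∈ Icc 0 T, state T x₀ Astar Bstar W μ (policy T Q R θ) t ω = X t ω)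
    {b : Fin d → ℝ} (hb0 : b ≠ 0) (hb : paramB θ *ᵥ b = 0) :
    ∃ v ≠ 0, expectedGram T x₀ Astar Bstar W μ (policy T Q R θ) *ᵥ v = 0 := by
  have hRt : R⁻¹ᵀ = R⁻¹ := by simpa using hR.inv.isHermitian.eq
  have hRu : IsUnit R := hR.isUnit
  have hRR : R⁻¹ * R = 1 := Matrix.nonsing_inv_mul _ ((Matrix.isUnit_iff_isUnit_det _).1 hRu)
  -- The factor `R` cancels the `R⁻¹` in the gain: `Kᵀ R b = -Pᵀ B R⁻¹ R b = -Pᵀ B b = 0` at every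
  -- time.
  refine ⟨Sum.elim 0 (R *ᵥ b), fun h0 ↦ hb0 ?_, ?_⟩
  · have h1 : R *ᵥ b = 0 := funext fun i ↦ congrFun h0 (Sum.inr i)
    exact Matrix.mulVec_injective_of_isUnit hRu (h1.trans (Matrix.mulVec_zero R).symm)
  · ext i
    rw [(hX.expectedGram_mulVec hW hT hQ hR hXs _ i).2]
    have : ∀ t, stateCoeff T Q R θ (Sum.elim 0 (R *ᵥ b)) t = 0 := fun t ↦ by
      rw [stateCoeff, Sum.elim_comp_inl, Sum.elim_comp_inr, zero_add, hamGain,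
        Matrix.transpose_neg, Matrix.transpose_mul, Matrix.transpose_mul, Matrix.transpose_transpose,
        hRt, Matrix.neg_mulVec, Matrix.mulVec_mulVec]
      generalize (hamRiccati _ _ _ _ _)ᵀ = P
      rw [Matrix.mul_assoc, Matrix.mul_assoc, hRR, Matrix.mul_one, ← Matrix.mulVec_mulVec, hb, Matrix.mulVec_zero, neg_zero]
    simp [dotProduct_stateInput, this]

end expectation

/-! ### Continuous dependence on the parameter -/

section continuity

/-- Compactness of `[0, T]` yields one neighbourhood valid for all times; the bound at `e` is
relaxed by 1 to leave room for nearby parameters. -/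
lemma eventually_absSum_le {E ι κ : Type*} [TopologicalSpace E] [Fintype ι] [Fintype κ]
    {F : E × ℝ → Matrix ι κ ℝ} (hF : Continuous F) (T : ℝ) (e : E) :
    ∃ k, 0 ≤ k ∧ ∀ᶠ x in 𝓝 e, ∀ t ∈ Icc 0 T, absSum (F (x, t)) ≤ k := by
  obtain ⟨k, hk0, hk⟩ := exists_absSum_le (F := fun t ↦ F (e, t)) (by fun_prop) T
  refine ⟨k + 1, by positivity, isCompact_Icc.eventually_forall_of_forall_eventually
    fun t ht ↦ ?_⟩
  have := ((continuous_absSum.comp hF).continuousAt (x := (e, t))).eventually_lt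
    (continuousAt_const (y := k + 1)) (lt_of_le_of_lt (hk t ht) (lt_add_one k))
  exact this.mono fun _ h ↦ h.le

variable [IsProbabilityMeasure μ] [μ.IsComplete]

/-- Solutions of the closed-loop equation depend continuously on the parameter. -/
lemma continuousAt_linearProcess {X : Matrix (Fin n ⊕ Fin d) (Fin n) ℝ → ℝ → Ω → Fin n → ℝ}
    (hX : ∀ θ, IsLinearProcess T x₀ (closedLoop Astar Bstar T Q R θ) W (X θ))
    (hQ : Q.PosDef) (hR : R.PosDef) (θ : Matrix (Fin n ⊕ Fin d) (Fin n) ℝ) {t : ℝ}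
    (ht : t ∈ Icc 0 T) (ω : Ω) : ContinuousAt (fun θ' ↦ X θ' t ω) θ := by
  obtain ⟨L, hL0, hL⟩ := eventually_absSum_le
    (continuous_closedLoop (Astar := Astar) (Bstar := Bstar) (T := T) hQ hR) T θ
  -- `G` involves only the fixed path `X θ`, so it is visibly continuous and vanishes at `θ`;
  -- stability bounds the difference of the states by `G` times a constant uniform near `θ`.
  set G : Matrix (Fin n ⊕ Fin d) (Fin n) ℝ → ℝ := fun θ' ↦ ∫ s in (0 : ℝ)..T,
    ‖(closedLoop Astar Bstar T Q R θ' s - closedLoop Astar Bstar T Q R θ s) *ᵥ X θ s ω‖ with hG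
  have hGc : Continuous G := by
    refine intervalIntegral.continuous_parametric_intervalIntegral_of_continuous'
      (f := fun θ' s ↦ ‖(closedLoop Astar Bstar T Q R θ' s -
        closedLoop Astar Bstar T Q R θ s) *ᵥ X θ s ω‖) ?_ 0 T
    have h1 := (continuous_closedLoop_right (Astar := Astar) (Bstar := Bstar) (T := T)
      hQ hR θ).comp (continuous_snd (X := Matrix (Fin n ⊕ Fin d) (Fin n) ℝ) (Y := ℝ))
    have h2 := ((hX θ).continuous ω).comp
      (continuous_snd (X := Matrix (Fin n ⊕ Fin d) (Fin n) ℝ) (Y := ℝ))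
    exact (((continuous_closedLoop hQ hR).sub h1).matrix_mulVec h2).norm
  have hG0 : G θ = 0 := by simp [hG]
  have hlim : Tendsto (fun θ' ↦ G θ' * Real.exp (L * T)) (𝓝 θ) (𝓝 0) := by
    have := (hGc.tendsto θ).mul_const (Real.exp (L * T))
    rwa [hG0, zero_mul] at this
  refine tendsto_iff_norm_sub_tendsto_zero.2 (squeeze_zero' (Eventually.of_forall fun _ ↦
    norm_nonneg _) ?_ hlim)
  filter_upwards [hL] with θ' hθ'
  exact ((hX θ').path ω).norm_sub_le (continuous_closedLoop_right hQ hR θ')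
    (continuous_closedLoop_right hQ hR θ) ((hX θ).path ω) hL0 hθ' ht

/-- The expected Gram matrix depends continuously on the parameter. -/
lemma continuousAt_expectedGram {X : Matrix (Fin n ⊕ Fin d) (Fin n) ℝ → ℝ → Ω → Fin n → ℝ}
    (hX : ∀ θ, IsLinearProcess T x₀ (closedLoop Astar Bstar T Q R θ) W (X θ))
    (hW : IsStandardBrownian W μ) (hT : 0 ≤ T) (hQ : Q.PosDef) (hR : R.PosDef)
    (hXs : ∀ θ, ∀ᵐ ω ∂μ, ∀ t ∈ Icc 0 T,
      state T x₀ Astar Bstar W μ (policy T Q R θ) t ω = X θ t ω)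
    (θ : Matrix (Fin n ⊕ Fin d) (Fin n) ℝ) :
    ContinuousAt (fun θ' ↦ expectedGram T x₀ Astar Bstar W μ (policy T Q R θ')) θ := by
  refine continuousAt_pi.2 fun i ↦ continuousAt_pi.2 fun j ↦ ?_
  simp only [fun θ' ↦ (hX θ').expectedGram_apply hW hT hQ hR (hXs θ') i j]
  obtain ⟨L, hL0, hL⟩ := eventually_absSum_le
    (continuous_closedLoop (Astar := Astar) (Bstar := Bstar) (T := T) hQ hR) T θ
  obtain ⟨k, hk0, hk⟩ := eventually_absSum_le (continuous_hamGain (T := T) hQ hR) T θ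
  have hae : ∀ᵐ p : Ω × ℝ ∂(μ.prod (volume.restrict (Ioc 0 T))), p.2 ∈ Ioc 0 T :=
    Measure.quasiMeasurePreserving_snd.ae (ae_restrict_mem measurableSet_Ioc)
  have : FirstCountableTopology (Matrix (Fin n ⊕ Fin d) (Fin n) ℝ) :=
    inferInstanceAs (FirstCountableTopology (Fin n ⊕ Fin d → Fin n → ℝ))
  -- The dominating function depends on `θ'` only through `L` and `k`, which are uniform near `θ`,
  -- and is integrable by the Brownian second moments.
  refine continuousAt_of_dominated
    (bound := fun p ↦ (1 + k) ^ 2 * (growthConst T L x₀ * dominator T W p.2 p.1))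
    (Eventually.of_forall fun θ' ↦ ?_) ?_
    (((hW.integrable_dominator_prod hT).const_mul _).const_mul _) ?_
  · have hm := measurable_pi_iff.1 ((hX θ').measurable_joint hQ hR)
    exact ((hm i).mul (hm j)).aestronglyMeasurable
  · filter_upwards [hL, hk] with θ' hL' hk'
    filter_upwards [hae] with p hp
    have hp' := Ioc_subset_Icc_self hp
    refine (abs_stateInput_mul_le (hk' _ hp') hk0 _ i j).trans ?_
    gcongr
    exact ((hX θ').path p.1).sq_norm_le (continuous_closedLoop_right hQ hR θ')
      (continuous_brownianPath p.1) hL0 hL' hp'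
  · filter_upwards [hae] with p hp
    have hx := continuousAt_linearProcess hX hQ hR θ (Ioc_subset_Icc_self hp) p.1
    have hK : ContinuousAt (fun θ' ↦ hamGain T Q R θ' p.2) θ :=
      (Continuous.comp (g := fun q : Matrix (Fin n ⊕ Fin d) (Fin n) ℝ × ℝ ↦
        hamGain T Q R q.1 q.2) (f := fun θ' ↦ (θ', p.2)) (continuous_hamGain hQ hR)
        (continuous_id.prodMk continuous_const)).continuousAt
    have hz : ∀ i, ContinuousAt (fun θ' ↦ stateInput T Q R θ' (X θ') p.2 p.1 i) θ := by
      intro i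
      have hx' := fun i ↦ (continuousAt_pi.1 hx) i
      have hK' := fun i j ↦ continuousAt_pi.1 (continuousAt_pi.1 hK i) j
      rcases i with i | i
      · exact hx' i
      · simp only [stateInput, Sum.elim_inr, Matrix.mulVec, dotProduct]
        fun_prop
    exact (hz i).mul (hz j)

end continuity

end

end LQRL

end

/-! ### Well-posedness and the equivalence -/

theorem proposition3p9 {n d : ℕ} (hn : 0 < n) (hd : 0 < d)
    {Ω : Type*} {mΩ : MeasurableSpace Ω} (μ : Measure Ω) [IsProbabilityMeasure μ] [μ.IsComplete]
    (W : ℝ≥0 → Ω → Fin n → ℝ) (hW : LQRL.IsStandardBrownian W μ)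
    (T : ℝ) (hT : 0 < T) (x₀ : Fin n → ℝ)
    (Astar : Matrix (Fin n) (Fin n) ℝ) (Bstar : Matrix (Fin n) (Fin d) ℝ)
    (Q : Matrix (Fin n) (Fin n) ℝ) (hQ : Q.PosDef)
    (R : Matrix (Fin d) (Fin d) ℝ) (hR : R.PosDef) :
    -- All objects are well defined: existence and uniqueness of `P^θ` and of `X^{ψ^θ}`,
    -- and integrability of `V^{ψ^θ}`.
    (∀ θ : Matrix (Fin n ⊕ Fin d) (Fin n) ℝ,
      LQRL.IsRiccatiSolution T Q R (LQRL.paramA θ) (LQRL.paramB θ) (LQRL.riccati T Q R θ) ∧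
      (∀ P, LQRL.IsRiccatiSolution T Q R (LQRL.paramA θ) (LQRL.paramB θ) P →
        Set.EqOn P (LQRL.riccati T Q R θ) (Set.Icc 0 T)) ∧
      LQRL.IsStateProcess T x₀ Astar Bstar W μ (LQRL.policy T Q R θ)
        (LQRL.state T x₀ Astar Bstar W μ (LQRL.policy T Q R θ)) ∧
      (∀ X, LQRL.IsStateProcess T x₀ Astar Bstar W μ (LQRL.policy T Q R θ) X →
        ∀ᵐ ω ∂μ, ∀ t ∈ Set.Icc 0 T,
          X t ω = LQRL.state T x₀ Astar Bstar W μ (LQRL.policy T Q R θ) t ω) ∧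
      (∀ i j, Integrable
        (fun ω ↦ LQRL.gram T x₀ Astar Bstar W μ (LQRL.policy T Q R θ) ω i j) μ)) ∧
    -- The equivalence.
    ∀ B : Matrix (Fin n) (Fin d) ℝ, List.TFAE [
      B.rank = d,
      ∀ A : Matrix (Fin n) (Fin n) ℝ,
        (LQRL.expectedGram T x₀ Astar Bstar W μ (LQRL.policy T Q R (LQRL.param A B))).PosDef,
      ∀ A : Matrix (Fin n) (Fin n) ℝ, ∃ lam₀ > 0, ∃ ε > 0,
        ∀ θ' : Matrix (Fin n ⊕ Fin d) (Fin n) ℝ,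
          LQRL.euclNorm (θ' - LQRL.param A B) ≤ ε →
            lam₀ ≤ LQRL.minEigenvalue
              (LQRL.expectedGram T x₀ Astar Bstar W μ (LQRL.policy T Q R θ'))] := by
  have exX := fun θ : Matrix (Fin n ⊕ Fin d) (Fin n) ℝ ↦
    LQRL.exists_isLinearProcess (Astar := Astar) (Bstar := Bstar) hW hT.le hQ hR x₀ θ
  choose X hX hXst using exX
  have hst := fun θ : Matrix (Fin n ⊕ Fin d) (Fin n) ℝ ↦
    LQRL.isStateProcess_state (Astar := Astar) (Bstar := Bstar) hW hT.le hQ hR x₀ θ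
  have hXs := fun θ ↦ (hst θ).ae_eq hW hQ hR (hXst θ)
  have hE : ∀ θ v, 0 ≤ v ⬝ᵥ
      (LQRL.expectedGram T x₀ Astar Bstar W μ (LQRL.policy T Q R θ) *ᵥ v) := fun θ v ↦ by
    rw [((hX θ).dotProduct_expectedGram hW hT.le hQ hR (hXs θ) v).2]
    exact integral_nonneg fun _ ↦ sq_nonneg _
  have hne : Nonempty (Fin n ⊕ Fin d) := ⟨Sum.inl ⟨0, hn⟩⟩
  refine ⟨fun θ ↦ ⟨LQRL.isRiccatiSolution_riccati hQ hR θ, fun P hP t ht ↦ ?_, hst θ,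
    fun Y hY ↦ hY.ae_eq hW hQ hR (hst θ),
    fun i j ↦ (hX θ).integrable_gram hW hT.le hQ hR (hXs θ) i j⟩, fun B ↦ ?_⟩
  · rw [hP.eqOn_hamRiccati hQ hR ht,
      (LQRL.isRiccatiSolution_riccati hQ hR θ).eqOn_hamRiccati hQ hR ht]
  have hpB : ∀ A, LQRL.paramB (LQRL.param A B) = B := fun A ↦ by
    simp [LQRL.paramB, LQRL.param]
  have hsing : B.rank ≠ d → ∀ A, ∃ v ≠ 0,
      LQRL.expectedGram T x₀ Astar Bstar W μ (LQRL.policy T Q R (LQRL.param A B)) *ᵥ v = 0 := by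
    intro hr A
    rw [ne_eq, LQRL.rank_eq_iff] at hr
    push Not at hr
    obtain ⟨b, hb, hb0⟩ := hr
    exact (hX _).exists_expectedGram_mulVec_eq_zero hW hT.le hQ hR (hXs _) hb0 (by rwa [hpB])
  tfae_have 1 → 2 := by
    intro hr A
    refine (hX _).posDef_expectedGram hW hT hQ hR (hXs _) ?_
    rw [hpB]
    exact (LQRL.rank_eq_iff B).1 hr
  tfae_have 2 → 3 := by
    intro h A
    obtain ⟨m, hm0, hm⟩ := LQRL.exists_pos_mul_sq_norm_le (h A)
    have hc := LQRL.continuousAt_expectedGram hX hW hT.le hQ hR hXs (LQRL.param A B)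
    have hs : ContinuousAt (fun θ ↦ LQRL.absSum
        (LQRL.expectedGram T x₀ Astar Bstar W μ (LQRL.policy T Q R θ) -
        LQRL.expectedGram T x₀ Astar Bstar W μ (LQRL.policy T Q R (LQRL.param A B))))
        (LQRL.param A B) :=
      LQRL.continuous_absSum.continuousAt.comp (hc.sub continuousAt_const)
    -- Half of the coercivity constant `m` at `θ` is spent on the perturbation; the remaining `m /
    -- 2`, divided by the dimension, bounds the smallest eigenvalue nearby.
    have hev := hs.eventually_lt (continuousAt_const (y := m / 2)) (by
      simp [LQRL.absSum, hm0])
    obtain ⟨ε, hε, hU⟩ := LQRL.exists_euclNorm_sub_le_imp hev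
    have hcard : (0 : ℝ) < Fintype.card (Fin n ⊕ Fin d) := by exact_mod_cast Fintype.card_pos
    refine ⟨m / 2 / Fintype.card (Fin n ⊕ Fin d), by positivity, ε, hε, fun θ' hθ' ↦ ?_⟩
    refine LQRL.le_minEigenvalue (LQRL.isHermitian_expectedGram _) (by positivity) fun v ↦ ?_
    have h1 := LQRL.abs_dotProduct_mulVec_le
      (LQRL.expectedGram T x₀ Astar Bstar W μ (LQRL.policy T Q R θ') -
        LQRL.expectedGram T x₀ Astar Bstar W μ (LQRL.policy T Q R (LQRL.param A B))) v
    have h2 := h1.trans (mul_le_mul_of_nonneg_right (le_of_lt (hU θ' hθ')) (sq_nonneg ‖v‖))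
    rw [Matrix.sub_mulVec, dotProduct_sub] at h2
    have h3 := (abs_le.1 h2).1
    have h4 := hm v
    linarith
  tfae_have 2 → 1 := by
    intro h
    by_contra hr
    -- Singularity holds for every `A`, so testing `A = 0` suffices.
    obtain ⟨v, hv0, hv⟩ := hsing hr 0
    have := (h 0).dotProduct_mulVec_pos hv0
    rw [hv, dotProduct_zero] at this
    exact lt_irrefl _ this
  tfae_have 3 → 1 := by
    intro h
    by_contra hr
    obtain ⟨v, hv0, hv⟩ := hsing hr 0
    obtain ⟨lam₀, hlam, ε, hε, hle⟩ := h 0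
    -- The centre of the ball is itself an admissible `θ'`.
    have h1 := hle (LQRL.param 0 B) (by simpa [LQRL.euclNorm] using hε.le)
    have h2 := LQRL.minEigenvalue_nonpos (hE _) hv0 hv
    linarith
  tfae_finish
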